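/- Conventions. Rings are commutative, noetherian, with unity, and $k$ is a field of arbitrary characteristic. A local $k$-algebra is a local ring $A$ containing $k$, with maximal ideal $\mathfrak{m}_A$, such that $A/\mathfrak{m}_A$ is a finite extension of $k$. A homomorphism of local $k$-algebras is a $k$-algebra homomorphism $\phi\colon A\to B$ with $\phi(\mathfrak{m}_A)\subset\mathfrak{m}_B$ (the residue field extension is then automatically finite). Let $k\langle x_1,\dots,x_n\rangle$ be the ring of elements of $k[[x_1,\dots,x_n]]$ that are algebraic over $k[x_1,\dots,x_n]$. If $k$ is a valued field, i.e. carries an absolute value $|\cdot|\colon k\to\mathbb{R}_{\ge 0}$, let $k\{x_1,\dots,x_n\}$ be the ring of convergent power series, i.e. of the series $\sum_\nu a_\nu x^\nu\in k[[x_1,\dots,x_n]]$ with $\sum_\nu |a_\nu| r^{|\nu|}<\infty$ for some $r>0$. A henselian (resp. analytic) $k$-algebra is a local $k$-algebra $A$ for which there exist $n\ge 0$ and an injective finite homomorphism of local $k$-algebras $k\langle x_1,\dots,x_n\rangle\to A$ (resp. $k\{x_1,\dots,x_n\}\to A$). Proposition 6.1. Let $\phi\colon A\to B$ be a homomorphism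 of local $k$-algebras, where either $k$ is a field and $A$ and $B$ are both henselian $k$-algebras, or $k$ is a valued field and $A$ and $B$ are both analytic $k$-algebras. Then $\phi$ is finite (i.e. $B$ is a finitely generated $A$-module via $\phi$) if and only if $\phi$ is quasi-finite, i.e. $B/\mathfrak{m}_A B$ is finite over $A/\mathfrak{m}_A$. -/

import Mathlib

/-- The ring `k⟨x₁, …, xₙ⟩` of algebraic power series: the formal power series that are algebraic
over the polynomial ring `k[x₁, …, xₙ]`, equivalently over its localization at `(x₁, …, xₙ)`. -/
noncomputable def algebraicPowerSeries (k : Type*) [Field k] (n : ℕ) :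
    Subalgebra k (MvPowerSeries (Fin n) k) :=
  (Subalgebra.algebraicClosure (MvPolynomial (Fin n) k)
    (MvPowerSeries (Fin n) k)).restrictScalars k

/-- A formal power series over a field with absolute value `v` is convergent if it is absolutely
convergent on some polydisc of positive radius, i.e. `∑ v(a_ν) r^|ν| < ∞` for some `r > 0`. -/
def IsConvergentSeries {k : Type*} [Field k] (v : AbsoluteValue k ℝ) {n : ℕ}
    (f : MvPowerSeries (Fin n) k) : Prop :=
  ∃ r : ℝ, 0 < r ∧ Summable fun ν : Fin n →₀ ℕ => v (MvPowerSeries.coeff ν f) * r ^ ν.degree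

theorem summable_of_radius_le {k : Type*} [Field k] (v : AbsoluteValue k ℝ) {n : ℕ}
    (f : MvPowerSeries (Fin n) k) {r s : ℝ} (hs : 0 ≤ s) (hsr : s ≤ r)
    (h : Summable fun ν : Fin n →₀ ℕ => v (MvPowerSeries.coeff ν f) * r ^ ν.degree) :
    Summable fun ν : Fin n →₀ ℕ => v (MvPowerSeries.coeff ν f) * s ^ ν.degree :=
  Summable.of_nonneg_of_le
    (fun _ => mul_nonneg (v.nonneg _) (pow_nonneg hs _))
    (fun _ => mul_le_mul_of_nonneg_left (pow_le_pow_left₀ hs hsr _) (v.nonneg _)) h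

theorem IsConvergentSeries.add {k : Type*} [Field k] {v : AbsoluteValue k ℝ} {n : ℕ}
    {f g : MvPowerSeries (Fin n) k} (hf : IsConvergentSeries v f) (hg : IsConvergentSeries v g) :
    IsConvergentSeries v (f + g) := by
  obtain ⟨r, hr, hf⟩ := hf
  obtain ⟨s, hs, hg⟩ := hg
  have ht : 0 < min r s := lt_min hr hs
  refine ⟨min r s, ht, ?_⟩
  refine Summable.of_nonneg_of_le (fun ν => mul_nonneg (v.nonneg _) (pow_nonneg ht.le _))
    (fun ν => ?_) ((summable_of_radius_le v f ht.le (min_le_left r s) hf).add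
      (summable_of_radius_le v g ht.le (min_le_right r s) hg))
  rw [map_add, ← add_mul]
  exact mul_le_mul_of_nonneg_right (v.add_le _ _) (pow_nonneg ht.le _)

theorem summable_coeff_mul {k : Type*} [Field k] {v : AbsoluteValue k ℝ} {n : ℕ}
    {f g : MvPowerSeries (Fin n) k} {t : ℝ} (ht : 0 < t)
    (hf' : Summable fun ν : Fin n →₀ ℕ => v (MvPowerSeries.coeff ν f) * t ^ ν.degree)
    (hg' : Summable fun ν : Fin n →₀ ℕ => v (MvPowerSeries.coeff ν g) * t ^ ν.degree) :
    Summable fun ν : Fin n →₀ ℕ => v (MvPowerSeries.coeff ν (f * g)) * t ^ ν.degree := by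
  have hprod := Summable.mul_of_nonneg hf' hg'
    (fun ν => mul_nonneg (v.nonneg (MvPowerSeries.coeff ν f)) (pow_nonneg ht.le ν.degree))
    (fun ν => mul_nonneg (v.nonneg (MvPowerSeries.coeff ν g)) (pow_nonneg ht.le ν.degree))
  have hfg := summable_sum_mul_antidiagonal_of_summable_mul
    (f := fun ν : Fin n →₀ ℕ => v (MvPowerSeries.coeff ν f) * t ^ ν.degree)
    (g := fun ν : Fin n →₀ ℕ => v (MvPowerSeries.coeff ν g) * t ^ ν.degree) hprod
  refine Summable.of_nonneg_of_le (fun _ => mul_nonneg (v.nonneg _) (pow_nonneg ht.le _))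
    (fun ν => ?_) hfg
  rw [MvPowerSeries.coeff_mul]
  refine (mul_le_mul_of_nonneg_right (v.sum_le _ _) (pow_nonneg ht.le _)).trans ?_
  rw [Finset.sum_mul]
  refine Finset.sum_le_sum fun p hp => le_of_eq ?_
  have hdeg : ν.degree = p.1.degree + p.2.degree := by
    rw [← Finset.HasAntidiagonal.mem_antidiagonal.mp hp, map_add]
  rw [hdeg, pow_add, map_mul, mul_mul_mul_comm]

theorem IsConvergentSeries.mul {k : Type*} [Field k] {v : AbsoluteValue k ℝ} {n : ℕ}
    {f g : MvPowerSeries (Fin n) k} (hf : IsConvergentSeries v f) (hg : IsConvergentSeries v g) :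
    IsConvergentSeries v (f * g) := by
  obtain ⟨r, hr, hf⟩ := hf
  obtain ⟨s, hs, hg⟩ := hg
  have ht : 0 < min r s := lt_min hr hs
  exact ⟨min r s, ht, summable_coeff_mul ht
    (summable_of_radius_le v f ht.le (min_le_left r s) hf)
    (summable_of_radius_le v g ht.le (min_le_right r s) hg)⟩

theorem isConvergentSeries_C {k : Type*} [Field k] (v : AbsoluteValue k ℝ) {n : ℕ} (a : k) :
    IsConvergentSeries v (MvPowerSeries.C a : MvPowerSeries (Fin n) k) := by
  classical
  refine ⟨1, one_pos, summable_of_ne_finset_zero (s := {0}) fun ν hν => ?_⟩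
  rw [MvPowerSeries.coeff_C, if_neg (by simpa using hν), map_zero, zero_mul]

/-- The ring `k{x₁, …, xₙ}` of convergent power series over the valued field `(k, v)`. -/
def convergentPowerSeries {k : Type*} [Field k] (v : AbsoluteValue k ℝ) (n : ℕ) :
    Subalgebra k (MvPowerSeries (Fin n) k) where
  carrier := {f | IsConvergentSeries v f}
  add_mem' := IsConvergentSeries.add
  mul_mem' := IsConvergentSeries.mul
  algebraMap_mem' := isConvergentSeries_C v

/-- A local `k`-algebra: a noetherian local ring containing `k` whose residue field is a finite
extension of `k`. (As `k` is a field, `k → A` is automatically injective.) -/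
structure IsLocalAlgebra (k A : Type*) [Field k] [CommRing A] [IsLocalRing A] [Algebra k A] :
    Prop where
  isNoetherianRing : IsNoetherianRing A
  finite_residueField : Module.Finite k (IsLocalRing.ResidueField A)

/-- A henselian `k`-algebra: a local `k`-algebra `A` with an injective and finite homomorphism of
local `k`-algebras `k⟨x₁, …, xₙ⟩ → A` for some `n`. -/
structure IsHenselianAlgebra (k A : Type*) [Field k] [CommRing A] [IsLocalRing A] [Algebra k A] :
    Prop extends IsLocalAlgebra k A where
  exists_finite_injective : ∃ (n : ℕ) (π : algebraicPowerSeries k n →ₐ[k] A),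
    IsLocalHom π ∧ Function.Injective π ∧ π.Finite

/-- An analytic `k`-algebra, for a field `k` with absolute value `v`: a local `k`-algebra `A` with
an injective and finite homomorphism of local `k`-algebras `k{x₁, …, xₙ} → A` for some `n`. -/
structure IsAnalyticAlgebra {k : Type*} [Field k] (v : AbsoluteValue k ℝ) (A : Type*) [CommRing A]
    [IsLocalRing A] [Algebra k A] : Prop extends IsLocalAlgebra k A where
  exists_finite_injective : ∃ (n : ℕ) (π : convergentPowerSeries v n →ₐ[k] A),
    IsLocalHom π ∧ Function.Injective π ∧ π.Finite

/-- `φ : A → B` is quasi-finite: the induced map `A/𝔪_A → B/𝔪_A B` is finite. -/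
def IsQuasiFiniteHom {A B : Type*} [CommRing A] [IsLocalRing A] [CommRing B] (φ : A →+* B) :
    Prop :=
  (Ideal.quotientMap ((IsLocalRing.maximalIdeal A).map φ) φ Ideal.le_comap_map).Finite

open MvPowerSeries
open scoped NNReal ENNReal

/-! Only "quasi-finite implies finite" needs an argument, and it is the same for henselian and
analytic algebras: all it uses of the rings `R n` of power series is Weierstrass division
(`IsWeierstrassFamily`). Let `α : R n → A` and `β : R m → B` be finite. Quasi-finiteness of `φ` and
finiteness of `α` put a power of the maximal ideal of `B` inside the ideal generated by the images
of the variables x of `R n`. Suppose the x and the variables y of `R m` together defined a map `R (n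
+ m) → B`. Then `B` would be a finite `R (n + m)`-module with y_j ^ e B ⊆ (x) B for all j. By
Cayley–Hamilton some series regular in y_j kills the module, and division by that series eliminates
y_j (`finite_of_var_zero`). Without the y, `B` is finite over `R n`, hence over `A`.

No substitution map into `B` itself is required: series are evaluated in the product of the
quotients of `B` by the powers of its maximal ideal, which contains `B` by Krull's intersection
theorem. Elimination is applied to the `R (n + m)`-submodule `N` generated by `B`; then `B` is an
`A`-submodule of a noetherian `A`-module (`finite_of_extension`).

It remains to see that formal Weierstrass division preserves each ring. For convergent series this
is a weighted ℓ¹ estimate (`mul_weightedNorm_le_of_coeff_eq`). For algebraic series, the roots of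
the Weierstrass polynomial of the divisor are algebraic, and the remainder is recovered by
interpolation at these roots (`exists_map_eq_of_eq_prod_mul_add`). Repeated roots are allowed, so
the characteristic plays no role. -/

theorem MvPowerSeries.finSuccEquiv_rename_succ {k : Type*} [CommSemiring k] {n : ℕ}
    (a : MvPowerSeries (Fin n) k) :
    finSuccEquiv k n (rename (Fin.succEmb n) a) = PowerSeries.C a := by
  ext i x
  rw [coeff_coeff_finSuccEquiv, PowerSeries.coeff_C]
  split_ifs with hi
  · subst hi
    rw [show Finsupp.cons 0 x = x.embDomain (Fin.succEmb n) from ?_, coeff_embDomain_rename]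
    ext j
    refine Fin.cases ?_ (fun j => ?_) j
    · rw [Finsupp.cons_zero, Finsupp.embDomain_of_notMem_range]
      simp
    · rw [Finsupp.cons_succ]
      exact (Finsupp.embDomain_apply_self (Fin.succEmb n) x j).symm
  · rw [coeff_rename_eq_zero, coeff_zero]
    rintro ⟨y, hy⟩
    have h0 := DFunLike.congr_fun hy 0
    rw [Finsupp.cons_zero, Finsupp.mapDomain_of_notMem_range _ _ (by simp)] at h0
    exact hi h0.symm

theorem Module.Finite.of_surjective_smul {A B M : Type*} [CommRing A] [CommRing B]
    [AddCommGroup M] [Module A M] [Module B M] [Module.Finite A M] (f : B →+* A)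
    (hf : Function.Surjective f) (h : ∀ (b : B) (z : M), b • z = f b • z) : Module.Finite B M := by
  obtain ⟨s, hs⟩ := Module.Finite.fg_top (R := A) (M := M)
  refine ⟨s, eq_top_iff.mpr fun z _ => ?_⟩
  have hz : z ∈ Submodule.span A (s : Set M) := hs ▸ trivial
  induction hz using Submodule.span_induction with
  | mem z hz => exact Submodule.subset_span hz
  | zero => simp
  | add x y _ _ hx hy => exact Submodule.add_mem _ (hx trivial) (hy trivial)
  | smul a x _ hx =>
    obtain ⟨b, rfl⟩ := hf a
    exact h b x ▸ Submodule.smul_mem _ b (hx trivial)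

/-- Weierstrass families: families of rings of power series, in any number of variables, which
contain the variables, are stable under renaming variables, and have Weierstrass division. -/
structure IsWeierstrassFamily {k : Type*} [Field k]
    (R : ∀ n, Subalgebra k (MvPowerSeries (Fin n) k)) : Prop where
  X_mem : ∀ {n} (i : Fin n), X i ∈ R n
  rename_mem : ∀ {n m} (e : Fin n ↪ Fin m) {f}, f ∈ R n → rename e f ∈ R m
  exists_division : ∀ {n} {F G : MvPowerSeries (Fin (n + 1)) k}, F ∈ R (n + 1) → G ∈ R (n + 1) →
    ∀ d : ℕ, PowerSeries.map constantCoeff (finSuccEquiv k n F) = PowerSeries.X ^ d →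
    ∃ Q ∈ R (n + 1), ∃ r : Polynomial (MvPowerSeries (Fin n) k), r.degree < d ∧
      (∀ i, r.coeff i ∈ R n) ∧ finSuccEquiv k n G = finSuccEquiv k n F * finSuccEquiv k n Q + r

/-! ### Consequences of Weierstrass division; elimination of variables -/

namespace IsWeierstrassFamily

variable {k : Type*} [Field k] {R : ∀ n, Subalgebra k (MvPowerSeries (Fin n) k)}

/-- The variables, as elements of a Weierstrass family. -/
noncomputable def var (W : IsWeierstrassFamily R) {n : ℕ} (i : Fin n) : R n := ⟨X i, W.X_mem i⟩

/-- The embedding of rings of a Weierstrass family induced by an injection of variables. -/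
noncomputable def emb (W : IsWeierstrassFamily R) {n m : ℕ} (e : Fin n ↪ Fin m) : R n →ₐ[k] R m :=
  ((rename e).comp (R n).val).codRestrict (R m) fun f => W.rename_mem e f.2

theorem emb_var (W : IsWeierstrassFamily R) {n m : ℕ} (e : Fin n ↪ Fin m) (i : Fin n) :
    W.emb e (W.var i) = W.var (e i) :=
  Subtype.ext (rename_X e i)

theorem emb_emb (W : IsWeierstrassFamily R) {n m l : ℕ} (e : Fin n ↪ Fin m) (e' : Fin m ↪ Fin l)
    (f : R n) : W.emb e' (W.emb e f) = W.emb (e.trans e') f :=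
  Subtype.ext (rename_rename e e' f.1)

/-- Weierstrass division, in terms of the ring of power series in one more variable. -/
theorem exists_eq_mul_add_sum (W : IsWeierstrassFamily R) {n : ℕ} (F G : R (n + 1)) (d : ℕ)
    (hF : PowerSeries.map constantCoeff (finSuccEquiv k n F.1) = PowerSeries.X ^ d) :
    ∃ (Q : R (n + 1)) (r : Fin d → R n),
      G = F * Q + ∑ i, W.emb (Fin.succEmb n) (r i) * W.var 0 ^ (i : ℕ) := by
  obtain ⟨Q, hQ, r, hr, hrR, h⟩ := W.exists_division F.2 G.2 d hF
  refine ⟨⟨Q, hQ⟩, fun i => ⟨r.coeff i, hrR i⟩, Subtype.ext ((finSuccEquiv k n).injective ?_)⟩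
  rw [h]
  have : (r : PowerSeries (MvPowerSeries (Fin n) k)) =
      ∑ i : Fin d, PowerSeries.C (r.coeff i) * PowerSeries.X ^ (i : ℕ) := by
    ext1 i
    simp only [Polynomial.coeff_coe, map_sum, PowerSeries.coeff_C_mul, PowerSeries.coeff_X_pow,
      mul_ite, mul_one, mul_zero]
    by_cases hi : i < d
    · rw [Finset.sum_eq_single ⟨i, hi⟩ (fun j _ hj => if_neg fun h => hj (Fin.ext h.symm))
        (by simp)]
      simp
    · rw [Polynomial.coeff_eq_zero_of_degree_lt (hr.trans_le (by simpa using hi)),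
        Finset.sum_eq_zero]
      exact fun j _ => if_neg fun h : i = j => hi (h ▸ j.2)
  rw [this]
  simp only [emb, var, Subalgebra.coe_add, Subalgebra.coe_mul, map_add, map_mul, map_sum,
    map_pow, add_right_inj, AddSubmonoidClass.coe_finsetSum, Subalgebra.coe_pow,
    finSuccEquiv_X_zero]
  exact Finset.sum_congr rfl fun i _ => by rw [← finSuccEquiv_rename_succ]; rfl

/-- Division by the first variable, with `d = 1`, leaves a remainder in one variable fewer. The
point is that the coefficients stay in `R n`. -/
theorem exists_eq_sum (W : IsWeierstrassFamily R) {n : ℕ} (f : R n)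
    (hf : constantCoeff f.1 = 0) : ∃ g : Fin n → R n, f = ∑ i, W.var i * g i := by
  induction n with
  | zero =>
    refine ⟨fun i => i.elim0, Subtype.ext ?_⟩
    ext ν
    rw [Subsingleton.elim ν 0]
    simpa using hf
  | succ n ih =>
    obtain ⟨Q, r, h⟩ := W.exists_eq_mul_add_sum (W.var 0) f 1 (by simp [var])
    have hr : constantCoeff (r 0).1 = 0 := by
      have := congrArg (fun f => constantCoeff f.1) h
      simpa [hf, var, emb] using this.symm
    obtain ⟨g, hg⟩ := ih (r 0) hr
    refine ⟨Fin.cons Q fun i => W.emb (Fin.succEmb n) (g i), ?_⟩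
    rw [h, Fin.sum_univ_succ (fun i => W.var i * _)]
    simp [hg, emb_var]

/-- Two homomorphisms out of a ring of a Weierstrass family which send each variable to the same
element of `J` agree modulo every power of `J`. -/
theorem sub_mem_pow (W : IsWeierstrassFamily R) {n : ℕ} {C : Type*} [CommRing C] [Algebra k C]
    (f g : R n →ₐ[k] C) (J : Ideal C) (hJ : ∀ i, f (W.var i) ∈ J)
    (h : ∀ i, f (W.var i) = g (W.var i)) (s : ℕ) (a : R n) : f a - g a ∈ J ^ s := by
  induction s generalizing a with
  | zero => simp
  | succ s ih =>
    obtain ⟨b, hb⟩ := W.exists_eq_sum (a - algebraMap k _ (constantCoeff a.1)) (by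
      simp [MvPowerSeries.algebraMap_apply])
    rw [sub_eq_iff_eq_add] at hb
    rw [hb]
    simp only [map_add, map_sum, map_mul, ← h, AlgHom.commutes, add_sub_add_right_eq_sub,
      ← Finset.sum_sub_distrib, ← mul_sub]
    exact sum_mem fun i _ => by rw [pow_succ']; exact Ideal.mul_mem_mul (hJ i) (ih _)

/-- A finite module over `R (n + 1)` on which a power of the first variable takes values in the
submodule generated by the other variables is finite over `R n`. -/
theorem finite_of_var_zero (W : IsWeierstrassFamily R) {n : ℕ} {M : Type*} [AddCommGroup M]
    [Module (R (n + 1)) M] [Module.Finite (R (n + 1)) M] [Module (R n) M]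
    (hM : ∀ (a : R n) (z : M), a • z = W.emb (Fin.succEmb n) a • z)
    (h : ∃ e : ℕ, ∀ z : M, (W.var 0 : R (n + 1)) ^ e • z ∈
      Ideal.span (Set.range fun i : Fin n => W.var i.succ) • (⊤ : Submodule (R (n + 1)) M)) :
    Module.Finite (R n) M := by
  obtain ⟨e, he⟩ := h
  set I : Ideal (R (n + 1)) := Ideal.span (Set.range fun i : Fin n => W.var i.succ)
  have hI : LinearMap.range (algebraMap (R (n + 1)) (Module.End (R (n + 1)) M) (W.var 0 ^ e)) ≤
      I • (⊤ : Submodule (R (n + 1)) M) := by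
    rintro _ ⟨z, rfl⟩
    exact he z
  -- Cayley–Hamilton: the coefficient of `p` at `i` lies in `I ^ (p.natDegree - i)`.
  obtain ⟨p, hp, -, hpI, hp0⟩ :=
    LinearMap.exists_monic_and_natDegree_eq_and_coeff_mem_pow_and_aeval_eq_zero _ _ I hI
  rw [Polynomial.aeval_algebraMap_apply] at hp0
  set F := Polynomial.aeval ((W.var 0 : R (n + 1)) ^ e) p
  have hF (z : M) : F • z = 0 := by simpa using LinearMap.congr_fun hp0 z
  -- Restriction to the axis of the first variable. All lower coefficients of `p` vanish there, so
  -- `F` restricts to a pure power and is a legitimate Weierstrass divisor.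
  let θ : R (n + 1) →+* PowerSeries k := (PowerSeries.map constantCoeff).comp
    ((finSuccEquiv k n).toAlgHom.toRingHom.comp (R (n + 1)).val.toRingHom)
  have hθ : I ≤ RingHom.ker θ := by
    rw [Ideal.span_le]
    rintro _ ⟨i, rfl⟩
    simp [θ, RingHom.mem_ker, var]
  have hpθ : p.map θ = Polynomial.X ^ p.natDegree := by
    ext1 i
    rw [Polynomial.coeff_map, Polynomial.coeff_X_pow]
    rcases lt_trichotomy i p.natDegree with hi | rfl | hi
    · rw [if_neg hi.ne]
      exact hθ (Ideal.pow_le_self (by lia) (hpI i))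
    · simp [hp.coeff_natDegree]
    · rw [if_neg hi.ne', Polynomial.coeff_eq_zero_of_natDegree_lt hi, map_zero]
  have hFθ : θ F = PowerSeries.X ^ (e * p.natDegree) := by
    rw [show F = p.eval ((W.var 0 : R (n + 1)) ^ e) from congrFun (Polynomial.coe_aeval_eq_eval _) p,
      ← Polynomial.eval₂_id, Polynomial.hom_eval₂, RingHom.comp_id, ← Polynomial.eval_map, hpθ]
    simp [θ, var, pow_mul]
  obtain ⟨s, hs⟩ := Module.Finite.fg_top (R := R (n + 1)) (M := M)
  let T := Submodule.span (R n)
    (Set.range fun q : Fin (e * p.natDegree) × s =>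
      (W.var 0 : R (n + 1)) ^ (q.1 : ℕ) • (q.2 : M))
  have key (z : M) (hz : z ∈ Submodule.span (R (n + 1)) (s : Set M)) :
      ∀ G : R (n + 1), G • z ∈ T := by
    induction hz using Submodule.span_induction with
    | mem z hz =>
      intro G
      -- Since `F` kills `M`, only the remainder acts, and it is a combination over `R n` of
      -- finitely many powers of the first variable.
      obtain ⟨Q, r, h⟩ := W.exists_eq_mul_add_sum F G _ hFθ
      rw [h, add_smul, mul_comm, mul_smul, hF, smul_zero, zero_add, Finset.sum_smul]
      refine sum_mem fun i _ => ?_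
      rw [mul_smul, ← hM]
      exact T.smul_mem _ (Submodule.subset_span ⟨(i, ⟨z, hz⟩), rfl⟩)
    | zero => simp
    | add x y _ _ hx hy => exact fun G => by rw [smul_add]; exact T.add_mem (hx G) (hy G)
    | smul b x _ hx => exact fun G => by rw [← mul_smul]; exact hx _
  refine ⟨(eq_top_iff.mpr fun z _ => ?_ : T = ⊤) ▸ Submodule.fg_span (Set.finite_range _)⟩
  simpa using key z (hs ▸ trivial) 1

/-- The last `n` of the variables of `R (n + m)`. -/
noncomputable abbrev embLast (W : IsWeierstrassFamily R) (n m : ℕ) : R n →ₐ[k] R (n + m) :=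
  W.emb (Fin.addNatEmb m)

/-- The first `m` of the variables of `R (n + m)`. -/
noncomputable abbrev embFirst (W : IsWeierstrassFamily R) (n m : ℕ) : R m →ₐ[k] R (n + m) :=
  W.emb (Fin.castLEEmb (Nat.le_add_left m n))

/-- Induction on `m`. The variables to be eliminated come first, so that `n + (m + 1)` unfolds to
`(n + m) + 1` and each step removes variable `0`. -/
theorem finite_of_embFirst (W : IsWeierstrassFamily R) {n : ℕ} {M : Type*} [AddCommGroup M]
    [i₀ : Module (R n) M] : ∀ (m : ℕ) [Module (R (n + m)) M] [Module.Finite (R (n + m)) M],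
    (∀ (a : R n) (z : M), a • z = W.embLast n m a • z) →
    (∀ j : Fin m, ∃ e : ℕ, ∀ z : M, ∃ w : Fin n → M,
      W.embFirst n m (W.var j) ^ e • z = ∑ i, W.embLast n m (W.var i) • w i) →
    Module.Finite (R n) M
  | 0, i₁, i₂, hM, _ => by
    refine @Module.Finite.of_surjective_smul (R (n + 0)) (R n) M _ _ _ i₁ i₀ i₂
      (W.embLast n 0).toRingHom (fun a => ⟨a, ?_⟩) hM
    exact Subtype.ext (congrArg (fun f => f a.1) (rename_id (σ := Fin n) (R := k)))
  | m + 1, _, _, hM, h => by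
    let _ : Module (R (n + m)) M := Module.compHom M (W.emb (Fin.succEmb (n + m))).toRingHom
    have hM' (a : R (n + m)) (z : M) :
        a • z = (show R (n + (m + 1)) from W.emb (Fin.succEmb (n + m)) a) • z := rfl
    have : Module.Finite (R (n + m)) M := by
      refine W.finite_of_var_zero (n := n + m) hM' ?_
      obtain ⟨e, he⟩ := h 0
      refine ⟨e, fun z => ?_⟩
      obtain ⟨w, hw⟩ := he z
      rw [emb_var] at hw
      refine (congrArg (· ∈ _) hw).mpr (sum_mem fun i _ => Submodule.smul_mem_smul ?_ trivial)
      rw [emb_var]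
      exact Ideal.subset_span ⟨i.addNat m, rfl⟩
    refine W.finite_of_embFirst m (fun a z => ?_) fun j => ?_
    · rw [hM', hM, emb_emb]
      rfl
    · obtain ⟨e, he⟩ := h j.succ
      refine ⟨e, fun z => ?_⟩
      obtain ⟨w, hw⟩ := he z
      refine ⟨w, ?_⟩
      simp only [hM', map_pow, emb_emb]
      simp only [emb_var] at hw ⊢
      exact hw

end IsWeierstrassFamily

/-- The evaluation of power series at elements of an ideal, modulo a power of the ideal. -/
theorem MvPowerSeries.exists_algHom_quotient_pow {k B : Type*} [Field k] [CommRing B] [Algebra k B]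
    {n : ℕ} (J : Ideal B) (c : Fin n → B) (hc : ∀ i, c i ∈ J) (s : ℕ) :
    ∃ ev : MvPowerSeries (Fin n) k →ₐ[k] B ⧸ J ^ s, ∀ i, ev (X i) = Ideal.Quotient.mk _ (c i) := by
  let f : MvPolynomial (Fin n) k →ₐ[k] B ⧸ J ^ s :=
    (Ideal.Quotient.mkₐ k (J ^ s)).comp (MvPolynomial.aeval c)
  have hJ : MvPolynomial.idealOfVars (Fin n) k ≤ J.comap (MvPolynomial.aeval (R := k) c) := by
    rw [MvPolynomial.idealOfVars, Ideal.span_le]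
    rintro _ ⟨i, rfl⟩
    simpa using hc i
  have hf (a : MvPolynomial (Fin n) k) (ha : a ∈ MvPolynomial.idealOfVars (Fin n) k ^ s) :
      f a = 0 :=
    Ideal.Quotient.eq_zero_iff_mem.mpr
      ((Ideal.pow_right_mono hJ s).trans (Ideal.le_comap_pow _ s) ha)
  -- Truncation sends a series to a polynomial class modulo the `s`-th power of the ideal of
  -- variables, on which `f` is well defined.
  refine ⟨(Ideal.Quotient.liftₐ _ f hf).comp ((truncTotalAlgHom (Fin n) k s).restrictScalars k),
    fun i => ?_⟩
  have : truncTotalAlgHom (Fin n) k s (X i) = Ideal.Quotient.mk _ (MvPolynomial.X i) := by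
    rw [← MvPolynomial.coe_X]
    exact (truncTotalAlgHom (Fin n) k s).commutes (MvPolynomial.X i)
  have hX : f (MvPolynomial.X i) = Ideal.Quotient.mk _ (c i) := by simp [f]
  rw [AlgHom.comp_apply, AlgHom.restrictScalars_apply, this, ← hX]
  rfl

/-! ### Fibres of local homomorphisms -/

theorem RingHom.Finite.quotientMap {D C : Type*} [CommRing D] [CommRing C] {f : D →+* C}
    (hf : f.Finite) (I : Ideal D) :
    (Ideal.quotientMap (I.map f) f Ideal.le_comap_map).Finite := by
  refine RingHom.Finite.of_comp_finite (f := Ideal.Quotient.mk I) ?_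
  rw [Ideal.quotientMap_comp_mk]
  exact (RingHom.Finite.of_surjective _ Ideal.Quotient.mk_surjective).comp hf

/-- The quotient of `C` is finite over a field, hence artinian, so its Jacobson radical is
nilpotent. -/
theorem IsLocalRing.exists_maximalIdeal_pow_le_map {D C : Type*} [CommRing D] [CommRing C]
    [IsLocalRing C] (f : D →+* C) (I : Ideal D) [I.IsMaximal]
    (hf : (Ideal.quotientMap (I.map f) f Ideal.le_comap_map).Finite) :
    ∃ e : ℕ, maximalIdeal C ^ e ≤ I.map f := by
  let _ := Ideal.Quotient.field I
  let _ : Algebra (D ⧸ I) (C ⧸ I.map f) := (Ideal.quotientMap (I.map f) f Ideal.le_comap_map).toAlgebra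
  have : Module.Finite (D ⧸ I) (C ⧸ I.map f) := hf
  have : IsArtinianRing (C ⧸ I.map f) := IsArtinianRing.of_finite (D ⧸ I) _
  obtain ⟨e, he⟩ := IsArtinianRing.isNilpotent_jacobson_bot (R := C ⧸ I.map f)
  have hm : (maximalIdeal C).map (Ideal.Quotient.mk (I.map f)) ≤ Ideal.jacobson ⊥ := by
    rw [Ideal.map_le_iff_le_comap]
    intro x hx
    rw [Ideal.mem_comap, Ideal.mem_jacobson_bot]
    intro y
    obtain ⟨y, rfl⟩ := Ideal.Quotient.mk_surjective y
    rw [← map_mul, ← map_one (Ideal.Quotient.mk (I.map f)), ← map_add]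
    refine IsUnit.map _ (of_not_not fun h => ?_)
    exact one_notMem_nonunits ((Ideal.add_mem_iff_right _
      (Ideal.mul_mem_right y (maximalIdeal C) hx)).mp h)
  refine ⟨e, fun x hx => Ideal.Quotient.eq_zero_iff_mem.mp ?_⟩
  have := Ideal.mem_map_of_mem (Ideal.Quotient.mk (I.map f)) hx
  rw [Ideal.map_pow] at this
  simpa [he] using Ideal.pow_right_mono hm e this

/-! ### The finiteness criterion over a Weierstrass family -/

namespace IsWeierstrassFamily

variable {k : Type*} [Field k] {R : ∀ n, Subalgebra k (MvPowerSeries (Fin n) k)}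

theorem isMaximal_span_var (W : IsWeierstrassFamily R) (n : ℕ) :
    (Ideal.span (Set.range (W.var (n := n)))).IsMaximal := by
  let θ : R n →+* k := (constantCoeff (R := k)).comp (R n).val.toRingHom
  have hθ : Function.Surjective θ := fun c => ⟨algebraMap k _ c, by
    simp [θ, MvPowerSeries.algebraMap_apply]⟩
  convert! RingHom.ker_isMaximal_of_surjective θ hθ
  refine le_antisymm (Ideal.span_le.mpr ?_) fun f hf => ?_
  · rintro _ ⟨i, rfl⟩
    simp [θ, RingHom.mem_ker, var]
  · obtain ⟨g, rfl⟩ := W.exists_eq_sum f hf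
    exact sum_mem fun i _ => Ideal.mul_mem_right _ _ (Ideal.subset_span ⟨i, rfl⟩)

theorem map_var_mem (W : IsWeierstrassFamily R) {n : ℕ} {A : Type*} [CommRing A] [IsLocalRing A]
    [Algebra k A] (π : R n →ₐ[k] A) (hπ : IsLocalHom π) (i : Fin n) :
    π (W.var i) ∈ IsLocalRing.maximalIdeal A := by
  rw [IsLocalRing.mem_maximalIdeal, mem_nonunits_iff]
  intro h
  have := ((hπ.map_nonunit _ h).map (R n).val).map (constantCoeff (R := k))
  simp [var] at this

/-- Finite generation over `R n`, phrased for additive submonoids so that it can be tested on a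
submodule over another ring, here an `A`-span. -/
theorem exists_finset_of_embFirst (W : IsWeierstrassFamily R) (n m : ℕ) {M : Type*} [AddCommGroup M]
    [Module (R (n + m)) M] [Module.Finite (R (n + m)) M]
    (h : ∀ j : Fin m, ∃ e : ℕ, ∀ z : M, ∃ w : Fin n → M,
      W.embFirst n m (W.var j) ^ e • z = ∑ i, W.embLast n m (W.var i) • w i) :
    ∃ s : Finset M, ∀ T : AddSubmonoid M, (s : Set M) ⊆ T →
      (∀ (a : R n), ∀ z ∈ T, W.embLast n m a • z ∈ T) → ∀ z, z ∈ T := by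
  let _ : Module (R n) M := Module.compHom M (W.embLast n m).toRingHom
  have hsmul (a : R n) (z : M) : a • z = W.embLast n m a • z := rfl
  obtain ⟨s, hs⟩ := (W.finite_of_embFirst m hsmul h).fg_top
  refine ⟨s, fun T hsT hT z => ?_⟩
  have hz : z ∈ Submodule.span (R n) (s : Set M) := hs ▸ trivial
  induction hz using Submodule.span_induction with
  | mem z hz => exact hsT hz
  | zero => exact zero_mem _
  | add x y _ _ hx hy => exact add_mem hx hy
  | smul a x _ hx => exact hT a x hx

/-- Finiteness over `R n` of a finite `R m`-algebra `B`, when the homomorphisms from `R n` and `R m`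
extend to `R (n + m)` after enlarging `B`. -/
theorem finite_of_extension (W : IsWeierstrassFamily R) {A B P : Type*}
    [CommRing A] [Algebra k A] [IsNoetherianRing A] [CommRing B] [Algebra k B]
    [CommRing P] [Algebra k P] (φ : A →ₐ[k] B) {n m : ℕ}
    (α : R n →ₐ[k] A) (β : R m →ₐ[k] B) (hβf : β.Finite)
    (ι : B →ₐ[k] P) (hι : Function.Injective ι) (ψ : R (n + m) →ₐ[k] P)
    (hψα : ∀ a, ψ (W.embLast n m a) = ι (φ (α a)))
    (hψβ : ∀ b, ψ (W.embFirst n m b) = ι (β b)) (e : ℕ)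
    (he : ∀ j, β (W.var j) ^ e ∈ Ideal.span (Set.range fun i => φ (α (W.var i)))) : φ.Finite := by
  let _ : Algebra (R (n + m)) P := ψ.toRingHom.toAlgebra
  let _ : Algebra A P := (ι.comp φ).toRingHom.toAlgebra
  let N : Submodule (R (n + m)) P := Submodule.span _ (Set.range ι)
  let _ : Module (R (n + m)) N := N.module
  let _ : Algebra (R m) B := β.toRingHom.toAlgebra
  have : Module.Finite (R m) B := hβf
  have hN : Module.Finite (R (n + m)) N := by
    classical
    obtain ⟨s, hs⟩ := Module.Finite.fg_top (R := R m) (M := B)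
    refine Module.Finite.iff_fg.mpr ⟨s.image ι, le_antisymm (Submodule.span_mono (by simp)) ?_⟩
    rw [Submodule.span_le]
    rintro _ ⟨b, rfl⟩
    have hb : b ∈ Submodule.span (R m) (s : Set B) := hs ▸ trivial
    induction hb using Submodule.span_induction with
    | mem b hb => exact Submodule.subset_span (by simpa using ⟨b, hb, rfl⟩)
    | zero => rw [map_zero]; exact zero_mem _
    | add x y _ _ hx hy => rw [map_add]; exact add_mem hx hy
    | smul a x _ hx =>
      have : ι (a • x) = W.embFirst n m a • ι x :=
        (map_mul ι (β a) x).trans (congrArg (· * ι x) (hψβ a).symm)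
      rw [this]
      exact Submodule.smul_mem _ _ hx
  -- `N` is stable under `B`, so the coefficients in `B` of the relation `he` can be absorbed into
  -- elements of `N`.
  have hιN (b : B) (z : P) (hz : z ∈ N) : ι b * z ∈ N := by
    induction hz using Submodule.span_induction with
    | mem z hz =>
      obtain ⟨b', rfl⟩ := hz
      rw [← map_mul]
      exact Submodule.subset_span ⟨_, rfl⟩
    | zero => simp
    | add x y _ _ hx hy => rw [mul_add]; exact add_mem hx hy
    | smul a x _ hx => rw [mul_smul_comm]; exact N.smul_mem _ hx
  obtain ⟨s, hs⟩ := W.exists_finset_of_embFirst n m (M := N) fun j => ⟨e, fun z => by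
    have hj := he j
    rw [Ideal.mem_span_range_iff_exists_fun] at hj
    obtain ⟨b, hb⟩ := hj
    refine ⟨fun i => ⟨ι (b i) * z, hιN _ _ z.2⟩, Subtype.ext ?_⟩
    have h1 : ((W.embFirst n m (W.var j) ^ e • z : N) : P) = ι (β (W.var j) ^ e) * z := by
      rw [map_pow ι, ← hψβ, ← map_pow ψ]
      rfl
    have h2 (i) (w : N) : ((W.embLast n m (W.var i) • w : N) : P) = ι (φ (α (W.var i))) * w := by
      rw [← hψα]
      rfl
    rw [h1, ← hb, map_sum, Finset.sum_mul, AddSubmonoidClass.coe_finsetSum]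
    refine Finset.sum_congr rfl fun i _ => ?_
    rw [h2, map_mul]
    ring⟩
  -- `R n` acts on `N` through `α`, so the `A`-span of the same generators contains `N`, and with it
  -- the image of `B`.
  let NA : Submodule A P := Submodule.span A (((↑) : N → P) '' s)
  have hNA : ∀ z : N, z ∈ NA.toAddSubmonoid.comap N.subtype.toAddMonoidHom := by
    refine hs _ (fun z hz => Submodule.subset_span ⟨z, hz, rfl⟩) fun a x hx => ?_
    have : ((W.embLast n m a • x : N) : P) = α a • (x : P) := congrArg (· * (x : P)) (hψα a)
    exact (congrArg (· ∈ NA) this).mpr (NA.smul_mem (α a) hx)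
  have : IsNoetherian A NA := isNoetherian_span_of_finite A (s.finite_toSet.image _)
  let _ : Algebra A B := φ.toRingHom.toAlgebra
  let ιA : B →ₗ[A] NA :=
    { toFun := fun b => ⟨ι b, hNA ⟨ι b, Submodule.subset_span ⟨b, rfl⟩⟩⟩
      map_add' := fun x y => Subtype.ext (map_add ι x y)
      map_smul' := fun a x => Subtype.ext (map_mul ι (φ a) x) }
  exact Module.Finite.of_injective ιA fun x y h => hι (congrArg Subtype.val h)

theorem finite_of_isQuasiFiniteHom (W : IsWeierstrassFamily R) {A B : Type*}
    [CommRing A] [IsLocalRing A] [Algebra k A] [IsNoetherianRing A]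
    [CommRing B] [IsLocalRing B] [Algebra k B] [IsNoetherianRing B]
    (φ : A →ₐ[k] B) (hφ : IsLocalHom φ) {n m : ℕ}
    (α : R n →ₐ[k] A) (hα : IsLocalHom α) (hαf : α.Finite)
    (β : R m →ₐ[k] B) (hβ : IsLocalHom β) (hβf : β.Finite)
    (hq : IsQuasiFiniteHom φ.toRingHom) : φ.Finite := by
  set 𝔪 := IsLocalRing.maximalIdeal B
  have hφα : IsLocalHom (φ.comp α) := ⟨fun a ha => hα.map_nonunit _ (hφ.map_nonunit _ ha)⟩
  -- the maximal ideal of `B` is nilpotent modulo the variables of `R n`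
  have hpow : ∃ e, 𝔪 ^ e ≤ Ideal.span (Set.range fun i => φ (α (W.var i))) := by
    have := W.isMaximal_span_var n
    obtain ⟨a, ha⟩ := IsLocalRing.exists_maximalIdeal_pow_le_map φ.toRingHom _ hq
    obtain ⟨b, hb⟩ := IsLocalRing.exists_maximalIdeal_pow_le_map α.toRingHom
      (Ideal.span (Set.range (W.var (n := n)))) (RingHom.Finite.quotientMap hαf _)
    refine ⟨a * b, ?_⟩
    rw [pow_mul]
    refine (Ideal.pow_right_mono ha b).trans ?_
    rw [← Ideal.map_pow]
    refine (Ideal.map_mono hb).trans ?_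
    rw [Ideal.map_map, Ideal.map_span, ← Set.range_comp]
    rfl
  obtain ⟨e, he⟩ := hpow
  -- the homomorphism from `R (n + m)` to the completion of `B`
  let P := ∀ s : ℕ, B ⧸ 𝔪 ^ s
  let ι : B →ₐ[k] P := AlgHom.pi fun s => Ideal.Quotient.mkₐ k (𝔪 ^ s)
  have hι : Function.Injective ι := by
    refine (injective_iff_map_eq_zero _).mpr fun b hb => ?_
    have : b ∈ (⨅ s : ℕ, 𝔪 ^ s) := by
      simp only [Submodule.mem_iInf]
      exact fun s => Ideal.Quotient.eq_zero_iff_mem.mp (congrFun hb s)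
    rwa [Ideal.iInf_pow_eq_bot_of_isLocalRing 𝔪 (IsLocalRing.maximalIdeal.isMaximal B).ne_top,
      Ideal.mem_bot] at this
  -- The first `m` variables go to `B` through `β`, the last `n` through `φ ∘ α`.
  let c : Fin (n + m) → B := fun i => if h : (i : ℕ) < m then β (W.var ⟨i, h⟩) else
    φ (α (W.var ⟨i - m, by lia⟩))
  have hc (i) : c i ∈ 𝔪 := by
    simp only [c]
    split_ifs
    exacts [W.map_var_mem β hβ _, W.map_var_mem (φ.comp α) hφα _]
  choose ev hev using MvPowerSeries.exists_algHom_quotient_pow (k := k) 𝔪 c hc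
  let ψ : R (n + m) →ₐ[k] P := AlgHom.pi fun s => (ev s).comp (R (n + m)).val
  have hψ (i) : ψ (W.var i) = ι (c i) := funext fun s => hev s i
  -- In each factor the image of the maximal ideal is nilpotent, so agreement on the variables
  -- forces equality.
  have agree {l : ℕ} (f : R l →ₐ[k] P) (g : R l →ₐ[k] B) (hg : IsLocalHom g)
      (h : ∀ i, f (W.var i) = ι (g (W.var i))) (a : R l) : f a = ι (g a) := by
    funext s
    have := W.sub_mem_pow ((Pi.evalAlgHom k _ s).comp f) ((Pi.evalAlgHom k _ s).comp (ι.comp g))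
      (𝔪.map (Ideal.Quotient.mk (𝔪 ^ s)))
      (fun i => by
        simp only [AlgHom.comp_apply, h]
        exact Ideal.mem_map_of_mem _ (W.map_var_mem g hg i)) (fun i => by simp [h]) s a
    rw [← Ideal.map_pow, Ideal.map_quotient_self, Ideal.mem_bot, sub_eq_zero] at this
    exact this
  have hψα : ∀ a, ψ (W.embLast n m a) = ι (φ (α a)) :=
    agree (ψ.comp (W.embLast n m)) (φ.comp α) hφα fun i => by
      simp [emb_var, hψ, c]
  have hψβ : ∀ b, ψ (W.embFirst n m b) = ι (β b) :=
    agree (ψ.comp (W.embFirst n m)) β hβ fun i => by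
      simp [emb_var, hψ, c]
  exact W.finite_of_extension φ α β hβf ι hι ψ hψα hψβ e fun j =>
    he (Ideal.pow_mem_pow (W.map_var_mem β hβ j) e)

end IsWeierstrassFamily

/-! ### Formal Weierstrass division -/

namespace MvPowerSeries

theorem mem_span_range_X {k : Type*} [Field k] {n : ℕ} (f : MvPowerSeries (Fin n) k)
    (hf : constantCoeff f = 0) : f ∈ Ideal.span (Set.range (X (σ := Fin n) (R := k))) := by
  induction n with
  | zero =>
    suffices f = 0 from this ▸ zero_mem _
    ext ν
    rw [Subsingleton.elim ν 0]
    simpa using hf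
  | succ n ih =>
    have h := PowerSeries.eq_X_mul_shift_add_const (finSuccEquiv k n f)
    rw [← finSuccEquiv_rename_succ, ← finSuccEquiv_X_zero,
      ← (finSuccEquiv k n).apply_symm_apply (PowerSeries.mk _), ← map_mul, ← map_add,
      (finSuccEquiv k n).injective.eq_iff] at h
    have h0 : constantCoeff (PowerSeries.constantCoeff (finSuccEquiv k n f)) = 0 := by
      have := congrArg constantCoeff h
      simpa [hf] using this.symm
    have h1 := Ideal.mem_map_of_mem (rename (R := k) (Fin.succEmb n)) (ih _ h0)
    rw [Ideal.map_span, ← Set.range_comp] at h1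
    rw [h]
    refine add_mem (Ideal.mul_mem_right _ _ (Ideal.subset_span ⟨0, rfl⟩))
      (Ideal.span_mono ?_ h1)
    rintro _ ⟨i, rfl⟩
    exact ⟨i.succ, (rename_X _ i).symm⟩

theorem mem_maximalIdeal_iff {k : Type*} [Field k] {n : ℕ} {f : MvPowerSeries (Fin n) k} :
    f ∈ IsLocalRing.maximalIdeal (MvPowerSeries (Fin n) k) ↔ constantCoeff f = 0 := by
  rw [IsLocalRing.mem_maximalIdeal, mem_nonunits_iff, MvPowerSeries.isUnit_iff_constantCoeff,
    isUnit_iff_ne_zero, not_not]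

theorem maximalIdeal_eq_span_range_X (k : Type*) [Field k] (n : ℕ) :
    IsLocalRing.maximalIdeal (MvPowerSeries (Fin n) k) = Ideal.span (Set.range X) := by
  refine le_antisymm (fun f hf => mem_span_range_X f (mem_maximalIdeal_iff.mp hf)) ?_
  rw [Ideal.span_le]
  rintro _ ⟨i, rfl⟩
  exact mem_maximalIdeal_iff.mpr (constantCoeff_X i)

instance isAdicComplete_maximalIdeal (k : Type*) [Field k] (n : ℕ) :
    IsAdicComplete (IsLocalRing.maximalIdeal (MvPowerSeries (Fin n) k))
      (MvPowerSeries (Fin n) k) := by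
  rw [maximalIdeal_eq_span_range_X]
  infer_instance

/-- A coefficient has zero residue exactly when its constant term vanishes, so regularity of order
`d` can be read in the residue field. -/
theorem order_map_residue {k : Type*} [Field k] {n : ℕ}
    {F : PowerSeries (MvPowerSeries (Fin n) k)} {d : ℕ}
    (hF : PowerSeries.map constantCoeff F = PowerSeries.X ^ d) :
    (F.map (IsLocalRing.residue (MvPowerSeries (Fin n) k))).order = d := by
  have h (i : ℕ) : PowerSeries.coeff i (F.map (IsLocalRing.residue _)) = 0 ↔ i ≠ d := by
    rw [PowerSeries.coeff_map, IsLocalRing.residue_eq_zero_iff, mem_maximalIdeal_iff,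
      ← PowerSeries.coeff_map, hF, PowerSeries.coeff_X_pow]
    simp
  exact PowerSeries.order_eq_nat.mpr ⟨fun h' => (h d).mp h' rfl, fun i hi => (h i).mpr hi.ne⟩

theorem map_residue_ne_zero {k : Type*} [Field k] {n : ℕ}
    {F : PowerSeries (MvPowerSeries (Fin n) k)} {d : ℕ}
    (hF : PowerSeries.map constantCoeff F = PowerSeries.X ^ d) :
    F.map (IsLocalRing.residue (MvPowerSeries (Fin n) k)) ≠ 0 := fun h => by
  simpa [h] using order_map_residue hF

theorem exists_eq_mul_add_of_map_constantCoeff {k : Type*} [Field k] {n : ℕ}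
    {F : PowerSeries (MvPowerSeries (Fin n) k)} {d : ℕ}
    (hF : PowerSeries.map constantCoeff F = PowerSeries.X ^ d)
    (G : PowerSeries (MvPowerSeries (Fin n) k)) :
    ∃ (Q : PowerSeries (MvPowerSeries (Fin n) k)) (r : Polynomial (MvPowerSeries (Fin n) k)),
      r.degree < d ∧ G = F * Q + r := by
  obtain ⟨Q, r, h⟩ := PowerSeries.exists_isWeierstrassDivision G (map_residue_ne_zero hF)
  refine ⟨Q, r, ?_, h.eq_mul_add⟩
  exact h.degree_lt.trans_eq (congrArg (fun o : ℕ∞ => (o.toNat : WithBot ℕ)) (order_map_residue hF))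

end MvPowerSeries

/-- An absolute value, with values in the nonnegative real numbers. -/
def AbsoluteValue.toNNReal {k : Type*} [Field k] (v : AbsoluteValue k ℝ) (a : k) : ℝ≥0 :=
  ⟨v a, v.nonneg a⟩

theorem AbsoluteValue.toNNReal_zero {k : Type*} [Field k] (v : AbsoluteValue k ℝ) :
    v.toNNReal 0 = 0 :=
  NNReal.eq v.map_zero

theorem AbsoluteValue.toNNReal_add_le {k : Type*} [Field k] (v : AbsoluteValue k ℝ) (a b : k) :
    v.toNNReal (a + b) ≤ v.toNNReal a + v.toNNReal b :=
  v.add_le a b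

/-! ### Weighted norms and the division estimate -/

namespace MvPowerSeries

/-- The weighted `ℓ¹`-norm of a power series. -/
noncomputable def weightedNorm {k σ : Type*} [Field k] (v : AbsoluteValue k ℝ)
    (w : (σ →₀ ℕ) → ℝ≥0) (f : MvPowerSeries σ k) : ℝ≥0∞ :=
  ∑' ν, ((v.toNNReal (coeff ν f) * w ν : ℝ≥0) : ℝ≥0∞)

variable {k σ : Type*} [Field k] (v : AbsoluteValue k ℝ)

theorem weightedNorm_mul_le {w : (σ →₀ ℕ) → ℝ≥0} (hw : ∀ a b, w (a + b) = w a * w b)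
    (f g : MvPowerSeries σ k) :
    weightedNorm v w (f * g) ≤ weightedNorm v w f * weightedNorm v w g := by
  classical
  simp only [weightedNorm]
  rw [← ENNReal.tsum_mul_right]
  simp_rw [← ENNReal.tsum_mul_left]
  rw [← ENNReal.tsum_prod (f := fun a b : σ →₀ ℕ =>
    ((v.toNNReal (coeff a f) * w a : ℝ≥0) : ℝ≥0∞) * ((v.toNNReal (coeff b g) * w b : ℝ≥0) : ℝ≥0∞)),
    ← Equiv.tsum_eq (Finset.HasAntidiagonal.sigmaAntidiagonalEquivProd (A := σ →₀ ℕ)),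
    ENNReal.tsum_sigma']
  refine ENNReal.tsum_le_tsum fun ν => ?_
  rw [tsum_fintype, Finset.univ_eq_attach]
  simp only [Finset.HasAntidiagonal.sigmaAntidiagonalEquivProd_apply]
  rw [Finset.sum_attach (Finset.HasAntidiagonal.antidiagonal ν) fun p =>
    ((v.toNNReal (coeff p.1 f) * w p.1 : ℝ≥0) : ℝ≥0∞) * ((v.toNNReal (coeff p.2 g) * w p.2 : ℝ≥0))]
  norm_cast
  have : v.toNNReal (coeff ν (f * g)) ≤
      ∑ p ∈ Finset.HasAntidiagonal.antidiagonal ν, v.toNNReal (coeff p.1 f) * v.toNNReal (coeff p.2 g) := by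
    rw [← NNReal.coe_le_coe, coeff_mul]
    push_cast
    exact (v.sum_le _ _).trans_eq (Finset.sum_congr rfl fun p _ => map_mul v _ _)
  refine (mul_le_mul_left this _).trans_eq ?_
  rw [Finset.sum_mul]
  refine Finset.sum_congr rfl fun p hp => ?_
  rw [← Finset.HasAntidiagonal.mem_antidiagonal.mp hp, hw]
  ring

theorem weightedNorm_mono {w w' : (σ →₀ ℕ) → ℝ≥0} {f : MvPowerSeries σ k} {c : ℝ≥0}
    (h : ∀ ν, coeff ν f ≠ 0 → w ν ≤ c * w' ν) : weightedNorm v w f ≤ c * weightedNorm v w' f := by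
  simp only [weightedNorm]
  rw [← ENNReal.tsum_mul_left]
  refine ENNReal.tsum_le_tsum fun ν => ?_
  norm_cast
  rw [mul_left_comm]
  by_cases hν : coeff ν f = 0
  · simp [hν, v.toNNReal_zero]
  · exact mul_le_mul_right (h ν hν) _

theorem isConvergentSeries_iff {n : ℕ} {f : MvPowerSeries (Fin n) k} :
    IsConvergentSeries v f ↔
      ∃ r : ℝ≥0, 0 < r ∧ weightedNorm v (fun ν => r ^ ν.degree) f ≠ ∞ := by
  have h (r : ℝ≥0) : (Summable fun ν : Fin n →₀ ℕ => v (coeff ν f) * (r : ℝ) ^ ν.degree) ↔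
      weightedNorm v (fun ν => r ^ ν.degree) f ≠ ∞ := by
    rw [weightedNorm, ENNReal.tsum_coe_ne_top_iff_summable, ← NNReal.summable_coe]
    rfl
  constructor
  · rintro ⟨r, hr, hs⟩
    exact ⟨⟨r, hr.le⟩, hr, (h _).mp hs⟩
  · rintro ⟨r, hr, hs⟩
    exact ⟨r, hr, (h _).mpr hs⟩

theorem weightedNorm_add_le (w : (σ →₀ ℕ) → ℝ≥0) (f g : MvPowerSeries σ k) :
    weightedNorm v w (f + g) ≤ weightedNorm v w f + weightedNorm v w g := by
  simp only [weightedNorm]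
  rw [← ENNReal.tsum_add]
  refine ENNReal.tsum_le_tsum fun ν => ?_
  norm_cast
  rw [← add_mul]
  exact mul_le_mul_left (v.toNNReal_add_le (coeff ν f) (coeff ν g)) _

/-- The degree of a monomial in all variables but the first. -/
def tailDegree {n : ℕ} (ν : Fin (n + 1) →₀ ℕ) : ℕ := ∑ i : Fin n, ν i.succ

theorem tailDegree_add {n : ℕ} (a b : Fin (n + 1) →₀ ℕ) :
    tailDegree (a + b) = tailDegree a + tailDegree b := by
  simp [tailDegree, Finset.sum_add_distrib]

theorem tailDegree_single {n : ℕ} (d : ℕ) :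
    tailDegree (Finsupp.single (0 : Fin (n + 1)) d) = 0 := by
  simp [tailDegree]

theorem tailDegree_le_degree {n : ℕ} (ν : Fin (n + 1) →₀ ℕ) : tailDegree ν ≤ ν.degree := by
  rw [Finsupp.degree_eq_sum, Fin.sum_univ_succ]
  exact Nat.le_add_left _ _

/-- The part of a power series of degree less than `M` in all variables but the first. -/
def tailTrunc {n : ℕ} (M : ℕ) (f : MvPowerSeries (Fin (n + 1)) k) : MvPowerSeries (Fin (n + 1)) k :=
  fun ν => if tailDegree ν < M then coeff ν f else 0

theorem coeff_tailTrunc {n : ℕ} (M : ℕ) (f : MvPowerSeries (Fin (n + 1)) k)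
    (ν : Fin (n + 1) →₀ ℕ) :
    coeff ν (tailTrunc M f) = if tailDegree ν < M then coeff ν f else 0 := rfl

theorem weightedNorm_le_of_tailTrunc {n : ℕ} {w : (Fin (n + 1) →₀ ℕ) → ℝ≥0}
    {f : MvPowerSeries (Fin (n + 1)) k} {C : ℝ≥0∞}
    (h : ∀ M, weightedNorm v w (tailTrunc M f) ≤ C) : weightedNorm v w f ≤ C := by
  rw [weightedNorm, ENNReal.tsum_eq_iSup_sum]
  refine iSup_le fun s => le_trans ?_ (h (s.sup tailDegree + 1))
  refine le_trans (Finset.sum_le_sum fun ν hν => ?_) (ENNReal.sum_le_tsum s)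
  rw [coeff_tailTrunc, if_pos (Nat.lt_succ_of_le (Finset.le_sup hν))]

/-- The norm estimate in Weierstrass division. -/
theorem mul_weightedNorm_le_of_coeff_eq {n : ℕ} {w : (Fin (n + 1) →₀ ℕ) → ℝ≥0}
    (hw : ∀ a b, w (a + b) = w a * w b) {Q G H : MvPowerSeries (Fin (n + 1)) k} {d : ℕ}
    (hH : ∀ ν, tailDegree ν = 0 → coeff ν H = 0)
    (hQ : ∀ ν, coeff ν Q = coeff (ν + .single 0 d) G + coeff (ν + .single 0 d) (H * Q))
    (hHw : 2 * weightedNorm v w H ≤ w (.single 0 d)) :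
    w (.single 0 d) * weightedNorm v w Q ≤ 2 * weightedNorm v w G := by
  set δ : Fin (n + 1) →₀ ℕ := .single 0 d
  -- Monomials of `H` have positive tail degree, so the part of `H * Q` of tail degree at most `M`
  -- involves `Q` only in tail degree below `M`. The induction starts at the zero truncation and
  -- never presupposes that the norm of `Q` is finite.
  have step (M : ℕ) : w δ * weightedNorm v w (tailTrunc (M + 1) Q) ≤
      weightedNorm v w G + weightedNorm v w H * weightedNorm v w (tailTrunc M Q) := by
    refine le_trans ?_ (add_le_add_right (weightedNorm_mul_le v hw _ _) _)
    refine le_trans ?_ (weightedNorm_add_le v w _ _)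
    conv_lhs => rw [weightedNorm]
    rw [← ENNReal.tsum_mul_left]
    refine le_trans (ENNReal.tsum_le_tsum fun ν => ?_)
      (ENNReal.tsum_comp_le_tsum_of_injective (add_left_injective δ) _)
    norm_cast
    rw [coeff_tailTrunc]
    split_ifs with hν
    · rw [hw, hQ, map_add]
      have : coeff (ν + δ) (H * Q) = coeff (ν + δ) (H * tailTrunc M Q) := by
        rw [coeff_mul, coeff_mul]
        refine Finset.sum_congr rfl fun p hp => ?_
        by_cases hp0 : tailDegree p.1 = 0
        · simp [hH _ hp0]
        · have := congrArg tailDegree (Finset.HasAntidiagonal.mem_antidiagonal.mp hp)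
          rw [tailDegree_add, tailDegree_add, tailDegree_single] at this
          rw [coeff_tailTrunc, if_pos (by lia)]
      rw [this]
      exact le_of_eq (by ring)
    · simp [v.toNNReal_zero]
  have bound (M : ℕ) : w δ * weightedNorm v w (tailTrunc M Q) ≤ 2 * weightedNorm v w G := by
    induction M with
    | zero =>
      have : tailTrunc 0 Q = 0 := by
        ext ν
        simp [coeff_tailTrunc]
      simp [this, weightedNorm, v.toNNReal_zero]
    | succ M ih =>
      refine (step M).trans ?_
      rw [two_mul]
      refine add_le_add_right ((ENNReal.mul_le_mul_iff_right two_ne_zero (by simp)).mp ?_) _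
      rw [← mul_assoc]
      exact (mul_le_mul_left hHw _).trans ih
  rcases eq_or_ne (w δ) 0 with h0 | h0
  · simp [h0]
  rw [mul_comm, ← ENNReal.le_div_iff_mul_le (.inl (by simpa using h0)) (.inl (by simp))]
  refine weightedNorm_le_of_tailTrunc v fun M => ?_
  rw [ENNReal.le_div_iff_mul_le (.inl (by simpa using h0)) (.inl (by simp)), mul_comm]
  exact bound M

end MvPowerSeries

/-! ### Weierstrass division of convergent series -/

namespace MvPowerSeries

variable {k : Type*} [Field k] (v : AbsoluteValue k ℝ)

theorem coeff_finSuccEquiv_eq {n : ℕ} (f : MvPowerSeries (Fin (n + 1)) k)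
    (ν : Fin (n + 1) →₀ ℕ) :
    coeff ν f = coeff ν.tail (PowerSeries.coeff (ν 0) (finSuccEquiv k n f)) := by
  rw [coeff_coeff_finSuccEquiv, Finsupp.cons_tail]

theorem tail_eq_zero_of_tailDegree {n : ℕ} {ν : Fin (n + 1) →₀ ℕ} (h : tailDegree ν = 0) :
    ν.tail = 0 := by
  ext i
  exact Finset.sum_eq_zero_iff.mp h i (Finset.mem_univ i)

theorem coeff_add_single_X_zero_pow_mul {n : ℕ} (f : MvPowerSeries (Fin (n + 1)) k) (d : ℕ)
    (ν : Fin (n + 1) →₀ ℕ) : coeff (ν + .single 0 d) (X 0 ^ d * f) = coeff ν f := by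
  rw [X_pow_eq, add_comm ν, coeff_add_monomial_mul, one_mul]

theorem weightedNorm_mono_left {n : ℕ} {f : MvPowerSeries (Fin n) k} {r s : ℝ≥0} (h : r ≤ s) :
    weightedNorm v (fun ν => r ^ ν.degree) f ≤ weightedNorm v (fun ν => s ^ ν.degree) f := by
  simpa using weightedNorm_mono v (c := 1) (f := f) (w := fun ν => r ^ ν.degree)
    (w' := fun ν => s ^ ν.degree) fun ν _ => by simpa using pow_le_pow_left' h _

theorem isConvergentSeries_of_mul_add {n : ℕ} {F G Q r : MvPowerSeries (Fin (n + 1)) k} {d : ℕ}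
    (hF : IsConvergentSeries v F) (hG : IsConvergentSeries v G)
    (hFd : PowerSeries.map constantCoeff (finSuccEquiv k n F) = PowerSeries.X ^ d)
    (hX : IsConvergentSeries v (X 0 : MvPowerSeries (Fin (n + 1)) k))
    (hr : ∀ ν, d ≤ ν 0 → coeff ν r = 0) (h : G = F * Q + r) : IsConvergentSeries v Q := by
  set H := X 0 ^ d - F
  have hHconv : IsConvergentSeries v H :=
    (convergentPowerSeries v (n + 1)).sub_mem
      ((convergentPowerSeries v (n + 1)).pow_mem hX d) hF
  have hH (ν) (hν : tailDegree ν = 0) : coeff ν H = 0 := by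
    rw [coeff_finSuccEquiv_eq, tail_eq_zero_of_tailDegree hν, coeff_zero_eq_constantCoeff_apply,
      ← PowerSeries.coeff_map]
    simp [H, hFd]
  have hQ (ν) : coeff ν Q = coeff (ν + .single 0 d) G + coeff (ν + .single 0 d) (H * Q) := by
    have hr' : coeff (ν + .single 0 d) r = 0 := hr _ (by simp)
    rw [← coeff_add_single_X_zero_pow_mul Q d ν, ← map_add, ← add_zero (coeff _ (_ * Q)), ← hr',
      ← map_add, h]
    congr 1
    simp only [H]
    ring
  obtain ⟨r₁, hr₁, hH₁⟩ := (isConvergentSeries_iff v).mp hHconv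
  obtain ⟨r₂, hr₂, hG₂⟩ := (isConvergentSeries_iff v).mp hG
  set ρ := min r₁ r₂
  have hρ : 0 < ρ := lt_min hr₁ hr₂
  have hHρ : weightedNorm v (fun ν => ρ ^ ν.degree) H ≠ ∞ :=
    ne_top_of_le_ne_top hH₁ (weightedNorm_mono_left v (min_le_left _ _))
  have hGρ : weightedNorm v (fun ν => ρ ^ ν.degree) G ≠ ∞ :=
    ne_top_of_le_ne_top hG₂ (weightedNorm_mono_left v (min_le_right _ _))
  -- Weighting all variables but the first by a further factor `ε ≤ 1` scales the norm of `H` by at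
  -- most `ε`, while the weight `ρ ^ d` of the leading monomial is unchanged.
  obtain ⟨ε₀, hε₀, hε₀H⟩ := ENNReal.exists_nnreal_pos_mul_lt
    (a := 2 * weightedNorm v (fun ν => ρ ^ ν.degree) H) (b := ((ρ ^ d : ℝ≥0) : ℝ≥0∞))
    (ENNReal.mul_ne_top (by simp) hHρ) (by simpa using fun h => absurd h hρ.ne')
  set ε := min ε₀ 1
  have hε : 0 < ε := lt_min hε₀ one_pos
  have hε1 : ε ≤ 1 := min_le_right _ _
  let w : (Fin (n + 1) →₀ ℕ) → ℝ≥0 := fun ν => ε ^ tailDegree ν * ρ ^ ν.degree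
  have hw (a b) : w (a + b) = w a * w b := by
    simp only [w, tailDegree_add, map_add, pow_add]
    ring
  have hwd : w (.single 0 d) = ρ ^ d := by simp [w, tailDegree_single]
  have hwH : weightedNorm v w H ≤ ε * weightedNorm v (fun ν => ρ ^ ν.degree) H :=
    weightedNorm_mono v fun ν hν =>
      mul_le_mul_left (pow_le_of_le_one zero_le hε1 fun h0 => hν (hH ν h0)) _
  have hwG : weightedNorm v w G ≤ 1 * weightedNorm v (fun ν => ρ ^ ν.degree) G :=
    weightedNorm_mono v fun ν _ => mul_le_mul_left (pow_le_one₀ zero_le hε1) _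
  have key := mul_weightedNorm_le_of_coeff_eq v hw hH hQ (by
    rw [hwd]
    refine le_trans ?_ hε₀H.le
    rw [mul_left_comm]
    refine mul_le_mul_right (hwH.trans (mul_le_mul_left ?_ _)) _
    exact_mod_cast min_le_left _ _)
  have hwQ : weightedNorm v w Q ≠ ∞ := fun htop => by
    rw [htop, hwd, ENNReal.mul_top (by simpa using fun h => absurd h hρ.ne'), top_le_iff] at key
    refine ENNReal.mul_ne_top (by simp) (ne_top_of_le_ne_top ?_ hwG) key
    simpa using hGρ
  refine (isConvergentSeries_iff v).mpr ⟨ε * ρ, mul_pos hε hρ, ne_top_of_le_ne_top hwQ ?_⟩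
  simpa using weightedNorm_mono v (c := 1) (f := Q) (w := fun ν => (ε * ρ) ^ ν.degree)
    (w' := w) fun ν _ => by
      rw [one_mul, mul_pow]
      exact mul_le_mul_left (pow_le_pow_right_of_le_one' hε1 (tailDegree_le_degree ν)) _

theorem isConvergentSeries_X {n : ℕ} (i : Fin n) :
    IsConvergentSeries v (X i : MvPowerSeries (Fin n) k) := by
  classical
  refine ⟨1, one_pos, summable_of_ne_finset_zero (s := {.single i 1}) fun ν hν => ?_⟩
  rw [coeff_X, if_neg (by simpa using hν), map_zero, zero_mul]

theorem isConvergentSeries_rename {n m : ℕ} (e : Fin n ↪ Fin m) {f : MvPowerSeries (Fin n) k}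
    (hf : IsConvergentSeries v f) : IsConvergentSeries v (rename e f) := by
  obtain ⟨r, hr, hs⟩ := hf
  refine ⟨r, hr, ?_⟩
  refine ((Finsupp.embDomain_injective e).summable_iff fun ν hν => ?_).mp ?_
  · rw [coeff_rename_eq_zero, map_zero, zero_mul]
    rintro ⟨x, rfl⟩
    exact hν ⟨x, Finsupp.embDomain_eq_mapDomain e x⟩
  · convert! hs using 2 with ν
    simp only [Function.comp_apply, coeff_embDomain_rename]
    congr 2
    rw [Finsupp.embDomain_eq_mapDomain, Finsupp.degree_mapDomain]

theorem isConvergentSeries_coeff_finSuccEquiv {n : ℕ} {f : MvPowerSeries (Fin (n + 1)) k}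
    (hf : IsConvergentSeries v f) (i : ℕ) :
    IsConvergentSeries v (PowerSeries.coeff i (finSuccEquiv k n f)) := by
  obtain ⟨r, hr, hs⟩ := hf
  refine ⟨r, hr, ?_⟩
  have hinj : Function.Injective fun x : Fin n →₀ ℕ => x.cons i := fun x y h =>
    (Finsupp.cons_injective2 h).2
  refine ((hs.comp_injective hinj).mul_left (r ^ i)⁻¹).congr fun x => ?_
  have : (x.cons i).degree = i + x.degree := by
    simp [Finsupp.degree_eq_sum, Fin.sum_univ_succ]
  simp only [Function.comp_apply, coeff_coeff_finSuccEquiv, this, pow_add]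
  field_simp

end MvPowerSeries

theorem isWeierstrassFamily_convergentPowerSeries {k : Type*} [Field k] (v : AbsoluteValue k ℝ) :
    IsWeierstrassFamily (convergentPowerSeries v) where
  X_mem := isConvergentSeries_X v
  rename_mem e _ hf := isConvergentSeries_rename v e hf
  exists_division {n F G} hF hG d hFd := by
    obtain ⟨Q, r, hr, h⟩ := exists_eq_mul_add_of_map_constantCoeff hFd (finSuccEquiv k n G)
    obtain ⟨Q, rfl⟩ := (finSuccEquiv k n).surjective Q
    obtain ⟨s, hs⟩ := (finSuccEquiv k n).surjective (r : PowerSeries (MvPowerSeries (Fin n) k))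
    have h' : G = F * Q + s := (finSuccEquiv k n).injective (by simpa [hs] using h)
    have hQ : IsConvergentSeries v Q := by
      refine isConvergentSeries_of_mul_add v hF hG hFd (isConvergentSeries_X v 0) (fun ν hν => ?_) h'
      rw [coeff_finSuccEquiv_eq, hs, Polynomial.coeff_coe,
        Polynomial.coeff_eq_zero_of_degree_lt (hr.trans_le (by simpa using hν)), map_zero]
    refine ⟨Q, hQ, r, hr, fun i => ?_, h⟩
    rw [← Polynomial.coeff_coe, ← hs]
    refine isConvergentSeries_coeff_finSuccEquiv v ?_ i
    rw [← sub_eq_of_eq_add' h']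
    exact Subalgebra.sub_mem _ hG (Subalgebra.mul_mem _ hF hQ)

/-! ### Algebraicity of remainders in one variable -/

namespace PowerSeries

open Polynomial in
/-- If a polynomial is divisible by `X - α` as a power series, then `α` is a root of it, as soon as
no nonzero element is divisible by every power of `α`. -/
theorem eval_eq_zero_of_coe_eq_mul {T : Type*} [CommRing T] {α : T}
    (hα : ∀ y : T, (∀ M : ℕ, α ^ M ∣ y) → y = 0) {p : T[X]} {V : PowerSeries T}
    (h : (p : PowerSeries T) = (PowerSeries.X - PowerSeries.C α) * V) : p.eval α = 0 := by
  have hcoeff (i : ℕ) : p.coeff i = PowerSeries.coeff i ((PowerSeries.X - PowerSeries.C α) * V) := by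
    rw [← h, Polynomial.coeff_coe]
  -- The partial sums at `α` telescope; this replaces evaluation of `V` at `α`, which need not make
  -- sense.
  have key (N : ℕ) : ∑ i ∈ Finset.range (N + 1), p.coeff i * α ^ i =
      -(α ^ (N + 1) * PowerSeries.coeff N V) := by
    induction N with
    | zero => simp [hcoeff, sub_mul]
    | succ N ih =>
      rw [Finset.sum_range_succ, ih, hcoeff, sub_mul, map_sub, PowerSeries.coeff_succ_X_mul,
        PowerSeries.coeff_C_mul]
      ring
  refine hα _ fun M => ?_
  rw [Polynomial.eval_eq_sum_range' (n := max M p.natDegree + 1) (by lia), key, dvd_neg]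
  exact (pow_dvd_pow α (by lia)).mul_right _

end PowerSeries

namespace Polynomial

theorem algebraMap_X_sub_C_powerSeries {K T : Type*} [CommRing K] [CommRing T] [Algebra K T] (a : K) :
    algebraMap K[X] (PowerSeries T) (X - C a) =
      PowerSeries.X - PowerSeries.C (algebraMap K T a) := by
  rw [PowerSeries.algebraMap_apply']
  simp

theorem X_sub_C_powerSeries_ne_zero {T : Type*} [CommRing T] [Nontrivial T] (α : T) :
    (PowerSeries.X - PowerSeries.C α : PowerSeries T) ≠ 0 := fun h => by
  simpa using congrArg (PowerSeries.coeff 1) h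

variable {K T : Type*} [CommRing K] [IsDomain K] [CommRing T] [IsDomain T] [Algebra K T]

/-- Factors `X - a` can be cancelled from a relation because `PowerSeries T` is a domain; the degree
of the leading coefficient drops each time. -/
theorem exists_aeval_eq_zero_not_C_X_sub_C_dvd {f : PowerSeries T} (hf : IsAlgebraic K[X] f)
    (a : K) : ∃ p : K[X][X], aeval f p = 0 ∧ ¬ C (X - C a) ∣ p := by
  obtain ⟨p, hp, hpf⟩ := hf
  induction hn : p.leadingCoeff.natDegree using Nat.strong_induction_on generalizing p with
  | _ n ih =>
    by_cases hdvd : C (X - C a) ∣ p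
    · obtain ⟨q, rfl⟩ := hdvd
      have hq : q ≠ 0 := right_ne_zero_of_mul hp
      refine ih _ ?_ q hq ?_ rfl
      · rw [← hn, leadingCoeff_mul, leadingCoeff_C,
          natDegree_mul (X_sub_C_ne_zero a) (leadingCoeff_ne_zero.mpr hq), natDegree_X_sub_C]
        lia
      · rw [map_mul, aeval_C, algebraMap_X_sub_C_powerSeries] at hpf
        exact (mul_eq_zero.mp hpf).resolve_left (X_sub_C_powerSeries_ne_zero _)
    · exact ⟨p, hpf, hdvd⟩

/-- A relation for `f` not divisible by `X - a` stays nonzero when `X` is set to `a`. Modulo `X -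
a`, `f` may be replaced by `r`, so the specialised relation vanishes at the value of `r`. -/
theorem isAlgebraic_eval_of_sub_eq_mul {a : K}
    (ha : ∀ y : T, (∀ M : ℕ, algebraMap K T a ^ M ∣ y) → y = 0) {f : PowerSeries T}
    (hf : IsAlgebraic K[X] f) {r : T[X]} {V : PowerSeries T}
    (h : f - (r : PowerSeries T) = (PowerSeries.X - PowerSeries.C (algebraMap K T a)) * V) :
    IsAlgebraic K (r.eval (algebraMap K T a)) := by
  obtain ⟨p, hpf, hp⟩ := exists_aeval_eq_zero_not_C_X_sub_C_dvd hf a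
  refine ⟨p.map (evalRingHom a), fun h0 => hp ?_, ?_⟩
  · rw [C_dvd_iff_dvd_coeff]
    intro i
    rw [dvd_iff_isRoot]
    simpa using congrArg (fun q => q.coeff i) h0
  · let pr : T[X] := p.eval₂ (mapRingHom (algebraMap K T)) r
    have hcoe : (pr : PowerSeries T) = aeval (r : PowerSeries T) p := by
      change coeToPowerSeries.ringHom pr = _
      rw [hom_eval₂, aeval_def]
      congr 1
      ext1
      · ext1 c
        simp [PowerSeries.algebraMap_apply']
      · simp [PowerSeries.algebraMap_apply']
    have hdvd : f - (r : PowerSeries T) ∣ aeval f p - aeval (r : PowerSeries T) p := by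
      simp only [aeval_def, ← eval_map]
      exact sub_dvd_eval_sub _ _ _
    rw [hpf, zero_sub, dvd_neg, ← hcoe, h] at hdvd
    obtain ⟨V', hV'⟩ := (dvd_mul_right _ V).trans hdvd
    have := PowerSeries.eval_eq_zero_of_coe_eq_mul ha hV'
    rw [← coe_evalRingHom, hom_eval₂] at this
    rw [aeval_def, eval₂_map, ← this]
    congr 1
    ext1
    · ext1 c
      simp
    · simp

/-- Newton interpolation, one root at a time: the value of `r` at a root is algebraic, hence in `K`;
subtracting it and dividing by the linear factor gives the same problem with one root fewer. -/
theorem exists_map_eq_of_eq_prod_mul_add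
    (hK : ∀ x : T, IsAlgebraic K x → x ∈ Set.range (algebraMap K T)) (s : Multiset T)
    (hs : ∀ α ∈ s, IsAlgebraic K α ∧ ∀ y : T, (∀ M : ℕ, α ^ M ∣ y) → y = 0)
    {f : PowerSeries T} (hf : IsAlgebraic K[X] f) {r : T[X]} (hr : r.degree < s.card)
    {V : PowerSeries T}
    (h : f = (s.map fun α => (PowerSeries.X - PowerSeries.C α : PowerSeries T)).prod * V + r) :
    ∃ r' : K[X], r'.map (algebraMap K T) = r := by
  induction s using Multiset.induction generalizing f r with
  | empty =>
    refine ⟨0, ?_⟩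
    rw [Multiset.card_zero, Nat.cast_zero, Nat.WithBot.lt_zero_iff, degree_eq_bot] at hr
    rw [hr, Polynomial.map_zero]
  | cons α s ih =>
    obtain ⟨hα, hsep⟩ := hs α (Multiset.mem_cons_self α s)
    obtain ⟨a, rfl⟩ := hK α hα
    rw [Multiset.map_cons, Multiset.prod_cons, mul_assoc] at h
    obtain ⟨c, hc⟩ := hK _ (isAlgebraic_eval_of_sub_eq_mul hsep hf (sub_eq_of_eq_add h))
    set α := algebraMap K T a
    set r₁ := r /ₘ (X - C α)
    have hr₁ : r = C (algebraMap K T c) + (X - C α) * r₁ := by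
      rw [hc, ← modByMonic_X_sub_C_eq_C_eval, modByMonic_add_div]
    set f₁ := (s.map fun α => (PowerSeries.X - PowerSeries.C α : PowerSeries T)).prod * V + r₁
    have hf₁ : algebraMap K[X] (PowerSeries T) (X - C a) * f₁ =
        f - algebraMap K[X] (PowerSeries T) (C c) := by
      rw [algebraMap_X_sub_C_powerSeries, h, hr₁]
      simp only [f₁, PowerSeries.algebraMap_apply']
      push_cast
      simp
      ring
    have hf₁alg : IsAlgebraic K[X] f₁ := by
      refine IsAlgebraic.of_mul (y := algebraMap K[X] (PowerSeries T) (X - C a)) ?_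
        (isAlgebraic_algebraMap _) (hf₁ ▸ hf.sub (isAlgebraic_algebraMap _))
      rw [algebraMap_X_sub_C_powerSeries]
      exact mem_nonZeroDivisors_of_ne_zero (X_sub_C_powerSeries_ne_zero _)
    obtain ⟨r', hr'⟩ := ih (fun β hβ => hs β (Multiset.mem_cons_of_mem hβ)) hf₁alg (r := r₁) (by
      rcases lt_or_ge r.degree (X - C α).degree with hlt | hge
      · rw [show r₁ = 0 from (divByMonic_eq_zero_iff (monic_X_sub_C α)).mpr hlt, degree_zero]
        exact WithBot.bot_lt_coe _
      · rw [← degree_add_divByMonic (monic_X_sub_C α) hge, degree_X_sub_C, Multiset.card_cons,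
          Nat.cast_succ, add_comm] at hr
        exact lt_of_add_lt_add_right hr) rfl
    refine ⟨C c + (X - C a) * r', ?_⟩
    rw [hr₁, ← hr']
    simp [α]

end Polynomial

/-- A monic polynomial over a domain splits over a finite extension which is a domain. -/
theorem Polynomial.Monic.exists_isDomain_splits_map.{u} {S : Type u} [CommRing S] [IsDomain S]
    {P : Polynomial S} (hP : P.Monic) :
    ∃ (T : Type u) (_ : CommRing T) (_ : IsDomain T) (_ : Algebra S T),
      Function.Injective (algebraMap S T) ∧ Module.Finite S T ∧
        (P.map (algebraMap S T)).Splits := by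
  obtain ⟨S', _, _, _, _, _, hS'⟩ := hP.exists_splits_map
  -- A prime lying over zero: its quotient is a domain in which `S` still embeds.
  obtain ⟨Q, -, hQ, hQS⟩ := Ideal.exists_ideal_over_prime_of_isIntegral (S := S') (⊥ : Ideal S) ⊥ (by
    rw [← RingHom.ker_eq_comap_bot, (RingHom.injective_iff_ker_eq_bot _).mp
      (FaithfulSMul.algebraMap_injective S S')])
  refine ⟨S' ⧸ Q, inferInstance, inferInstance, inferInstance, ?_, inferInstance, ?_⟩
  · rw [RingHom.injective_iff_ker_eq_bot, ← hQS, IsScalarTower.algebraMap_eq S S' (S' ⧸ Q),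
      ← RingHom.comap_ker]
    congr 1
    exact Ideal.mk_ker
  · rw [IsScalarTower.algebraMap_eq S S' (S' ⧸ Q), ← Polynomial.map_map]
    exact hS'.map _

/-- A root of a distinguished polynomial lies in any maximal ideal over that of `S`, so Krull's
intersection theorem in the noetherian domain `T` applies. -/
theorem Polynomial.IsDistinguishedAt.eq_zero_of_forall_pow_dvd {S T : Type*} [CommRing S]
    [IsLocalRing S] [IsNoetherianRing S] [CommRing T] [IsDomain T] [Algebra S T]
    (hinj : Function.Injective (algebraMap S T)) [Module.Finite S T] {P : Polynomial S}
    (hP : P.IsDistinguishedAt (IsLocalRing.maximalIdeal S)) {α : T}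
    (hα : Polynomial.aeval α P = 0) (y : T) (hy : ∀ M : ℕ, α ^ M ∣ y) : y = 0 := by
  have : IsNoetherianRing T := IsNoetherianRing.of_finite S T
  obtain ⟨Q, hQ, hQS⟩ := Ideal.exists_ideal_over_maximal_of_isIntegral (S := T)
    (IsLocalRing.maximalIdeal S) (by
      rw [(RingHom.injective_iff_ker_eq_bot _).mp hinj]; exact bot_le)
  have hαQ : α ∈ Q := by
    refine hQ.isPrime.mem_of_pow_mem P.natDegree ?_
    rw [Polynomial.aeval_eq_sum_range, Finset.sum_range_succ, hP.monic.coeff_natDegree, one_smul,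
      add_comm] at hα
    rw [eq_neg_of_add_eq_zero_left hα]
    refine neg_mem (sum_mem fun i hi => ?_)
    rw [Algebra.smul_def]
    refine Ideal.mul_mem_right _ _ ?_
    rw [← Ideal.mem_comap, hQS]
    exact hP.mem (Finset.mem_range.mp hi)
  have h : y ∈ (⨅ M : ℕ, Ideal.span {α} ^ M) := by
    simp only [Submodule.mem_iInf, Ideal.span_singleton_pow, Ideal.mem_span_singleton]
    exact hy
  rwa [Ideal.iInf_pow_eq_bot_of_isDomain _ fun htop => hQ.ne_top (top_le_iff.mp
    (htop ▸ (Ideal.span_singleton_le_iff_mem Q).mpr hαQ)), Ideal.mem_bot] at h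

/-! ### Weierstrass division of algebraic series -/

namespace MvPowerSeries

variable {k : Type*} [Field k]

instance isDomain_fin (n : ℕ) : IsDomain (MvPowerSeries (Fin n) k) :=
  NoZeroDivisors.to_isDomain _

theorem mem_algebraicPowerSeries {n : ℕ} {f : MvPowerSeries (Fin n) k} :
    f ∈ algebraicPowerSeries k n ↔ IsAlgebraic (MvPolynomial (Fin n) k) f := Iff.rfl

theorem isAlgebraic_X {n : ℕ} (i : Fin n) :
    IsAlgebraic (MvPolynomial (Fin n) k) (X i : MvPowerSeries (Fin n) k) := by
  rw [← MvPolynomial.coe_X]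
  exact isAlgebraic_algebraMap (MvPolynomial.X i)

theorem isAlgebraic_rename {n m : ℕ} (e : Fin n ↪ Fin m) {f : MvPowerSeries (Fin n) k}
    (hf : IsAlgebraic (MvPolynomial (Fin n) k) f) :
    IsAlgebraic (MvPolynomial (Fin m) k) (rename e f) :=
  hf.ringHom_of_comp_eq (MvPolynomial.rename e : MvPolynomial (Fin n) k →ₐ[k] _) (rename e)
    (MvPolynomial.rename_injective e e.injective)
    (RingHom.ext fun p => (rename_coe e p).symm)

theorem isAlgebraic_map_finSuccEquiv {n : ℕ} {K T : Type*} [CommRing K] [CommRing T] [Algebra K T]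
    [Algebra (MvPolynomial (Fin n) k) K] [Algebra (MvPowerSeries (Fin n) k) T]
    (hK : Function.Injective (algebraMap (MvPolynomial (Fin n) k) K))
    (h : (algebraMap K T).comp (algebraMap (MvPolynomial (Fin n) k) K) =
      (algebraMap (MvPowerSeries (Fin n) k) T).comp (algebraMap (MvPolynomial (Fin n) k) _))
    {f : MvPowerSeries (Fin (n + 1)) k} (hf : IsAlgebraic (MvPolynomial (Fin (n + 1)) k) f) :
    IsAlgebraic (Polynomial K)
      (PowerSeries.map (algebraMap (MvPowerSeries (Fin n) k) T) (finSuccEquiv k n f)) := by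
  refine hf.ringHom_of_comp_eq
    ((Polynomial.mapRingHom (algebraMap (MvPolynomial (Fin n) k) K)).comp
      (MvPolynomial.finSuccEquiv k n).toAlgHom.toRingHom)
    ((PowerSeries.map (algebraMap (MvPowerSeries (Fin n) k) T)).comp
      (finSuccEquiv k n).toAlgHom.toRingHom)
    ((Polynomial.map_injective _ hK).comp (MvPolynomial.finSuccEquiv k n).injective) ?_
  have h' (p) : algebraMap K T (algebraMap (MvPolynomial (Fin n) k) K p) =
      algebraMap (MvPowerSeries (Fin n) k) T p := RingHom.congr_fun h p
  refine MvPolynomial.ringHom_ext (fun c => ?_) fun i => ?_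
  · have h1 : MvPolynomial.finSuccEquiv k n (MvPolynomial.C c) =
        Polynomial.C (MvPolynomial.C c)  := by
      simp [MvPolynomial.finSuccEquiv_apply]
    simp [PowerSeries.algebraMap_apply', h', algebraMap_apply', h1]
  · refine Fin.cases ?_ (fun i => ?_) i
    · simp [PowerSeries.algebraMap_apply', algebraMap_apply', MvPolynomial.finSuccEquiv_X_zero]
    · simp [PowerSeries.algebraMap_apply', h', algebraMap_apply', MvPolynomial.finSuccEquiv_X_succ]

theorem finSuccEquiv_ne_zero {n : ℕ} {F : PowerSeries (MvPowerSeries (Fin n) k)} {d : ℕ}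
    (hFd : PowerSeries.map constantCoeff F = PowerSeries.X ^ d) : F ≠ 0 := by
  rintro rfl
  rw [map_zero] at hFd
  exact pow_ne_zero d PowerSeries.X_ne_zero hFd.symm

theorem isAlgebraic_coeff_of_eq_mul_add {n : ℕ} {F G : MvPowerSeries (Fin (n + 1)) k}
    (hF : IsAlgebraic (MvPolynomial (Fin (n + 1)) k) F)
    (hG : IsAlgebraic (MvPolynomial (Fin (n + 1)) k) G) {d : ℕ}
    (hFd : PowerSeries.map constantCoeff (finSuccEquiv k n F) = PowerSeries.X ^ d)
    {Q : PowerSeries (MvPowerSeries (Fin n) k)} {r : Polynomial (MvPowerSeries (Fin n) k)}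
    (hr : r.degree < d) (h : finSuccEquiv k n G = finSuccEquiv k n F * Q + r) (i : ℕ) :
    IsAlgebraic (MvPolynomial (Fin n) k) (r.coeff i) := by
  obtain ⟨P, U, hPU⟩ := PowerSeries.exists_isWeierstrassFactorization (map_residue_ne_zero hFd)
  have hPd : P.natDegree = d := by
    rw [hPU.natDegree_eq_toNat_order_map, order_map_residue hFd, ENat.toNat_natCast]
  have hP := hPU.isDistinguishedAt
  obtain ⟨T, _, _, _, hinj, _, hsplit⟩ := hP.monic.exists_isDomain_splits_map
  let _ : Algebra (MvPolynomial (Fin n) k) T :=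
    ((algebraMap (MvPowerSeries (Fin n) k) T).comp (algebraMap (MvPolynomial (Fin n) k) _)).toAlgebra
  have : IsScalarTower (MvPolynomial (Fin n) k) (MvPowerSeries (Fin n) k) T :=
    IsScalarTower.of_algebraMap_eq fun _ => rfl
  have hinj' : Function.Injective (algebraMap (MvPolynomial (Fin n) k) T) :=
    hinj.comp (MvPolynomial.coe_injective _ _)
  -- `K` is algebraically closed in `T`, so to be algebraic over `K` is to lie in `K`.
  let K := Subalgebra.algebraicClosure (MvPolynomial (Fin n) k) T
  have hK (x : T) (hx : IsAlgebraic K x) : x ∈ Set.range (algebraMap K T) :=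
    ⟨⟨x, hx.restrictScalars (MvPolynomial (Fin n) k)⟩, rfl⟩
  have hinjK : Function.Injective (algebraMap (MvPolynomial (Fin n) k) K) :=
    Function.Injective.of_comp (f := algebraMap K T) hinj'
  have hmap := fun {f} => isAlgebraic_map_finSuccEquiv (n := n) (K := K) (T := T) (f := f) hinjK rfl
  set g := PowerSeries.map (algebraMap (MvPowerSeries (Fin n) k) T)
  set s := (P.map (algebraMap _ T)).roots
  have hs : P.map (algebraMap _ T) = (s.map fun α => Polynomial.X - Polynomial.C α).prod :=
    hsplit.eq_prod_roots_of_monic (hP.monic.map _)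
  have hcard : s.card = d := by
    rw [← hsplit.natDegree_eq_card_roots, hP.monic.natDegree_map, hPd]
  have hgP : g P = (s.map fun α => (PowerSeries.X - PowerSeries.C α : PowerSeries T)).prod := by
    rw [← Polynomial.polynomial_map_coe, hs, ← Polynomial.coeToPowerSeries.ringHom_apply,
      map_multiset_prod, Multiset.map_map]
    exact congrArg _ (Multiset.map_congr rfl fun α _ => by simp)
  have hgF : g (finSuccEquiv k n F) ≠ 0 := fun h0 =>
    finSuccEquiv_ne_zero hFd (PowerSeries.map_injective _ hinj (h0.trans (map_zero g).symm))
  have hroot (α : T) (hα : α ∈ s) :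
      IsAlgebraic K α ∧ ∀ y : T, (∀ M : ℕ, α ^ M ∣ y) → y = 0 := by
    have hsep := hP.eq_zero_of_forall_pow_dvd hinj (α := α) (by
      rw [← Polynomial.eval_map_algebraMap]
      exact (Polynomial.mem_roots'.mp hα).2)
    refine ⟨?_, hsep⟩
    -- A nonzero algebraic series divides a nonzero polynomial `c`. Hence `X - α` divides `c`, and
    -- `α` is a root of it.
    obtain ⟨c, hc, hdvd⟩ := (hmap hF).exists_nonzero_dvd (mem_nonZeroDivisors_of_ne_zero hgF)
    refine ⟨c, hc, ?_⟩
    have : (PowerSeries.X - PowerSeries.C α : PowerSeries T) ∣ algebraMap (Polynomial K) _ c := by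
      refine (?_ : _ ∣ g (finSuccEquiv k n F)).trans hdvd
      rw [hPU.eq_mul, map_mul, hgP]
      exact (Multiset.dvd_prod (Multiset.mem_map_of_mem _ hα)).mul_right _
    obtain ⟨V, hV⟩ := this
    rw [PowerSeries.algebraMap_apply', ← Polynomial.polynomial_map_coe] at hV
    rw [← Polynomial.eval_map_algebraMap]
    exact PowerSeries.eval_eq_zero_of_coe_eq_mul hsep hV
  obtain ⟨r', hr'⟩ := Polynomial.exists_map_eq_of_eq_prod_mul_add hK s hroot (hmap hG)
    (r := r.map (algebraMap _ T)) (V := g U * g Q) (by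
      rw [hcard]
      exact Polynomial.degree_map_le.trans_lt hr) (by
      rw [h, hPU.eq_mul, map_add, map_mul, map_mul, hgP, mul_assoc,
        ← Polynomial.polynomial_map_coe])
  have hri : algebraMap _ T (r.coeff i) = r'.coeff i := by
    rw [← Polynomial.coeff_map, ← hr', Polynomial.coeff_map]
    rfl
  refine (isAlgebraic_algebraMap_iff hinj).mp ?_
  rw [hri]
  exact (r'.coeff i).2

/-- `F * Q` is `G` minus a polynomial in the first variable with algebraic coefficients, and the
nonzero algebraic factor `F` can be cancelled. -/
theorem isAlgebraic_of_eq_mul_add {n : ℕ} {F G : MvPowerSeries (Fin (n + 1)) k}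
    (hF : IsAlgebraic (MvPolynomial (Fin (n + 1)) k) F)
    (hG : IsAlgebraic (MvPolynomial (Fin (n + 1)) k) G) (hF0 : F ≠ 0)
    {Q : MvPowerSeries (Fin (n + 1)) k} {r : Polynomial (MvPowerSeries (Fin n) k)}
    (hr : ∀ i, IsAlgebraic (MvPolynomial (Fin n) k) (r.coeff i))
    (h : finSuccEquiv k n G = finSuccEquiv k n F * finSuccEquiv k n Q + r) :
    IsAlgebraic (MvPolynomial (Fin (n + 1)) k) Q := by
  refine IsAlgebraic.of_mul (y := F) (mem_nonZeroDivisors_of_ne_zero hF0) hF ?_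
  have : F * Q = G - ∑ i ∈ Finset.range (r.natDegree + 1),
      rename (Fin.succEmb n) (r.coeff i) * X 0 ^ i := by
    refine (finSuccEquiv k n).injective ?_
    have hsum : (r : PowerSeries (MvPowerSeries (Fin n) k)) = ∑ i ∈ Finset.range (r.natDegree + 1),
        PowerSeries.C (r.coeff i) * PowerSeries.X ^ i := by
      conv_lhs => rw [r.as_sum_range_C_mul_X_pow, ← Polynomial.coeToPowerSeries.ringHom_apply]
      simp
    rw [map_sub, h, map_sum, map_mul, eq_sub_iff_add_eq, add_right_inj, hsum]
    exact Finset.sum_congr rfl fun i _ => by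
      rw [map_mul, map_pow, finSuccEquiv_rename_succ, finSuccEquiv_X_zero]
  rw [this]
  have hX : IsAlgebraic (MvPolynomial (Fin (n + 1)) k)
      (X 0 : MvPowerSeries (Fin (n + 1)) k) := isAlgebraic_X 0
  have hterm (i : ℕ) : IsAlgebraic (MvPolynomial (Fin (n + 1)) k)
      (rename (Fin.succEmb n) (r.coeff i) * X 0 ^ i) :=
    (isAlgebraic_rename (Fin.succEmb n) (hr i)).mul (hX.pow i)
  have hsum (s : Finset ℕ) : IsAlgebraic (MvPolynomial (Fin (n + 1)) k)
      (∑ i ∈ s, rename (Fin.succEmb n) (r.coeff i) * X 0 ^ i) :=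
    Finset.sum_induction _ _ (fun _ _ ha hb => ha.add hb) isAlgebraic_zero fun i _ => hterm i
  exact hG.sub (hsum _)

end MvPowerSeries

theorem isWeierstrassFamily_algebraicPowerSeries (k : Type*) [Field k] :
    IsWeierstrassFamily (algebraicPowerSeries k) where
  X_mem i := mem_algebraicPowerSeries.mpr (isAlgebraic_X i)
  rename_mem e _ hf :=
    mem_algebraicPowerSeries.mpr (isAlgebraic_rename e (mem_algebraicPowerSeries.mp hf))
  exists_division {n F G} hF hG d hFd := by
    rw [mem_algebraicPowerSeries] at hF hG
    obtain ⟨Q, r, hr, h⟩ := exists_eq_mul_add_of_map_constantCoeff hFd (finSuccEquiv k n G)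
    obtain ⟨Q, rfl⟩ := (finSuccEquiv k n).surjective Q
    have hri := isAlgebraic_coeff_of_eq_mul_add hF hG hFd hr h
    have hF0 : F ≠ 0 := fun h0 => finSuccEquiv_ne_zero hFd (by rw [h0, map_zero])
    exact ⟨Q, mem_algebraicPowerSeries.mpr (isAlgebraic_of_eq_mul_add hF hG hF0 hri h), r, hr,
      fun i => mem_algebraicPowerSeries.mpr (hri i), h⟩

/-! ### The equivalence of finite and quasi-finite -/

theorem RingHom.Finite.isQuasiFiniteHom {A B : Type*} [CommRing A] [IsLocalRing A] [CommRing B]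
    {φ : A →+* B} (hφ : φ.Finite) : IsQuasiFiniteHom φ :=
  hφ.quotientMap _

theorem proposition6p1 {k A B : Type*} [Field k]
    [CommRing A] [IsLocalRing A] [Algebra k A]
    [CommRing B] [IsLocalRing B] [Algebra k B]
    (φ : A →ₐ[k] B) (hφ : IsLocalHom φ) :
    (IsHenselianAlgebra k A → IsHenselianAlgebra k B →
      (φ.Finite ↔ IsQuasiFiniteHom φ.toRingHom)) ∧
    (∀ v : AbsoluteValue k ℝ, IsAnalyticAlgebra v A → IsAnalyticAlgebra v B →
      (φ.Finite ↔ IsQuasiFiniteHom φ.toRingHom)) := by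
  refine ⟨fun hA hB => ⟨RingHom.Finite.isQuasiFiniteHom, fun hq => ?_⟩,
    fun v hA hB => ⟨RingHom.Finite.isQuasiFiniteHom, fun hq => ?_⟩⟩
  · obtain ⟨n, α, hα, -, hαf⟩ := hA.exists_finite_injective
    obtain ⟨m, β, hβ, -, hβf⟩ := hB.exists_finite_injective
    have := hA.isNoetherianRing
    have := hB.isNoetherianRing
    exact (isWeierstrassFamily_algebraicPowerSeries k).finite_of_isQuasiFiniteHom φ hφ α hα hαf
      β hβ hβf hq
  · obtain ⟨n, α, hα, -, hαf⟩ := hA.exists_finite_injective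
    obtain ⟨m, β, hβ, -, hβf⟩ := hB.exists_finite_injective
    have := hA.isNoetherianRing
    have := hB.isNoetherianRing
    exact (isWeierstrassFamily_convergentPowerSeries v).finite_of_isQuasiFiniteHom φ hφ α hα hαf
      β hβ hβf hq
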